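/- Let $X$ be a compact connected Riemann surface, $S\subset X$ a finite subset (also regarded as a reduced effective divisor), and $E_*=(E,\{E_{x,j}\},\{\alpha_{x,j}\})$ a parabolic vector bundle on $X$ with parabolic divisor $S$: $E$ is a holomorphic vector bundle of positive rank, and for every $x\in S$ there are given a filtration of the fibre $E_x=E_{x,1}\supset E_{x,2}\supset\cdots\supset E_{x,l_x}\supset E_{x,l_x+1}=0$ by subspaces and real weights $0\le\alpha_{x,1}<\cdots<\alpha_{x,l_x}<1$. Let $\mathcal E_{x,j}=\ker(E\to E_x/E_{x,j})$. Let $\mathrm{End}^P(E_*)$ be the sheaf of $\mathcal O_X$-linear endomorphisms of $E$ which map each $\mathcal E_{x,j}$ into itself, let $\mathrm{At}(E_*)\subset \mathrm{Diff}^1(E,E)$ be the sheaf of holomorphic differential operators of order at most one which map each $\mathcal E_{x,j}$ ($x\in S$, $1\le j\le l_x$) into itself and whose symbol lies in $TX\otimes\mathcal O_X(-S)=\mathrm{Id}_E\otimes TX\otimes\mathcal O_X(-S)\subset \mathrm{End}(E)\otimes TX$, and let $$0\to \mathrm{End}^P(E_*)\to \mathrm{At}(E_*)\xrightarrow{\ \sigma\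 } TX\otimes\mathcal O_X(-S)\to 0$$ be the Atiyah exact sequence of $E_*$, where $\sigma$ is the symbol map. A holomorphic splitting of it is an $\mathcal O_X$-linear homomorphism $\mathbf h: TX\otimes\mathcal O_X(-S)\to \mathrm{At}(E_*)$ with $\sigma\circ\mathbf h=\mathrm{Id}$. A logarithmic connection $D:E\to E\otimes K_X\otimes\mathcal O_X(S)$ is associated to $\mathbf h$ if $\langle D(s),v\rangle=\mathbf h(v)(s)$ for all local holomorphic sections $s$ of $E$ and $v$ of $TX\otimes\mathcal O_X(-S)$. A connection on $E_*$ is a logarithmic connection $D$ on $E$, singular over $S$, such that for all $x\in S$ and $1\le j\le l_x$ the residue satisfies $\mathrm{Res}(D,x)(E_{x,j})\subset E_{x,j}$ and induces $\alpha_{x,j}\cdot\mathrm{Id}$ on $E_{x,j}/E_{x,j+1}$. Then every holomorphic splitting $\mathbf h$ of the Atiyah exact sequence of $E_*$ has exactly one associated logarithmic connection $D$ on $E$, and its residues preserve all the subspaces $E_{x,j}$. Moreover, giving a connection on $E_*$ is equivalent to giving a holomorphic splitting $\mathbf h$ whose associated logarithmic connection $D$ satisfies: for all $x\in S$ and $1\le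 j\le l_x$ the residue $\mathrm{Res}(D,x)$ induces the endomorphism $\alpha_{x,j}\cdot\mathrm{Id}$ of $E_{x,j}/E_{x,j+1}$. That is, there is a bijection between the set of connections on $E_*$ and the set of such splittings, under which every connection on $E_*$ is the logarithmic connection associated to the corresponding splitting. -/

import Mathlib

open Bundle TopologicalSpace
open scoped Manifold ContDiff

noncomputable section

namespace ParabolicBundle

section Sections

set_option linter.unusedSectionVars false

/-- Extension by zero of a (dependent) function on the open set `U`. -/
def zeroExt {X : Type*} [TopologicalSpace X] {W : X → Type*} [∀ x, Zero (W x)] (U : Opens X)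
    (s : ∀ x : U, W x) (x : X) : W x :=
  open Classical in if h : x ∈ U then s ⟨x, h⟩ else 0

theorem zeroExt_of_mem {X : Type*} [TopologicalSpace X] {W : X → Type*} [∀ x, Zero (W x)]
    {U : Opens X} (s : ∀ x : U, W x) {x : X} (h : x ∈ U) : zeroExt U s x = s ⟨x, h⟩ := dif_pos h

variable {X : Type*} [TopologicalSpace X] [ChartedSpace ℂ X]

/-- The ring `𝒪(U)` of holomorphic functions on `U`. -/
structure Hol (U : Opens X) where
  toFun : U → ℂ
  holo : ContMDiffOn 𝓘(ℂ) 𝓘(ℂ) ω (zeroExt (W := fun _ => ℂ) U toFun) U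

namespace Hol

instance (U : Opens X) : CoeFun (Hol U) (fun _ => U → ℂ) := ⟨Hol.toFun⟩

@[ext] theorem ext {U : Opens X} {f g : Hol U} (h : ∀ x, f x = g x) : f = g := by
  cases f; cases g; congr; exact funext h

instance (U : Opens X) : Zero (Hol U) := ⟨⟨fun _ => 0, (contMDiffOn_const (c := (0 : ℂ))).congr
  fun _ hx => zeroExt_of_mem (W := fun _ => ℂ) _ hx⟩⟩
instance (U : Opens X) : One (Hol U) := ⟨⟨fun _ => 1, (contMDiffOn_const (c := (1 : ℂ))).congr
  fun _ hx => zeroExt_of_mem (W := fun _ => ℂ) _ hx⟩⟩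
instance (U : Opens X) : Add (Hol U) := ⟨fun f g => ⟨fun x => f x + g x,
  (ContMDiffOn.add f.holo g.holo).congr fun _ hx => by
    simp [zeroExt_of_mem (W := fun _ => ℂ) _ hx]⟩⟩
instance (U : Opens X) : Mul (Hol U) := ⟨fun f g => ⟨fun x => f x * g x,
  (ContMDiffOn.mul f.holo g.holo).congr fun _ hx => by
    simp [zeroExt_of_mem (W := fun _ => ℂ) _ hx]⟩⟩
instance (U : Opens X) : Neg (Hol U) := ⟨fun f => ⟨fun x => - f x,
  (ContMDiffOn.neg f.holo).congr fun _ hx => by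
    simp [zeroExt_of_mem (W := fun _ => ℂ) _ hx]⟩⟩

@[simp] theorem zero_apply {U : Opens X} (x : U) : (0 : Hol U) x = 0 := rfl
@[simp] theorem one_apply {U : Opens X} (x : U) : (1 : Hol U) x = 1 := rfl
@[simp] theorem add_apply {U : Opens X} (f g : Hol U) (x : U) : (f + g) x = f x + g x := rfl
@[simp] theorem mul_apply {U : Opens X} (f g : Hol U) (x : U) : (f * g) x = f x * g x := rfl
@[simp] theorem neg_apply {U : Opens X} (f : Hol U) (x : U) : (-f) x = -f x := rfl

instance (U : Opens X) : CommRing (Hol U) where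
  add_assoc f g h := ext fun x => by simp [add_assoc]
  zero_add f := ext fun x => by simp
  add_zero f := ext fun x => by simp
  add_comm f g := ext fun x => by simp [add_comm]
  neg_add_cancel f := ext fun x => by simp
  mul_assoc f g h := ext fun x => by simp [mul_assoc]
  one_mul f := ext fun x => by simp
  mul_one f := ext fun x => by simp
  zero_mul f := ext fun x => by simp
  mul_zero f := ext fun x => by simp
  left_distrib f g h := ext fun x => by simp [mul_add]
  right_distrib f g h := ext fun x => by simp [add_mul]
  mul_comm f g := ext fun x => by simp [mul_comm]
  nsmul := nsmulRec
  zsmul := zsmulRec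

/-- Restriction of holomorphic functions. -/
def res {U W : Opens X} (h : W ≤ U) (f : Hol U) : Hol W :=
  ⟨fun x => f ⟨x, h x.2⟩, (f.holo.mono h).congr fun x hx => by
    rw [zeroExt_of_mem (W := fun _ => ℂ) _ hx, zeroExt_of_mem (W := fun _ => ℂ) _ (h hx)]⟩

@[simp] theorem res_apply {U W : Opens X} (h : W ≤ U) (f : Hol U) (x : W) :
    f.res h x = f ⟨x, h x.2⟩ := rfl

/-- The differential `df_x : T_x X → ℂ` of a holomorphic function. -/
def d {U : Opens X} (f : Hol U) (x : U) : TangentSpace 𝓘(ℂ) (x : X) →L[ℂ] ℂ :=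
  mvfderiv 𝓘(ℂ) (zeroExt (W := fun _ => ℂ) U f) (x : X)

theorem d_res {U W : Opens X} (h : W ≤ U) (f : Hol U) (x : W) :
    (f.res h).d x = f.d ⟨x, h x.2⟩ := by
  have h1 : zeroExt (W := fun _ => ℂ) W (f.res h) =ᶠ[nhds (x : X)]
      zeroExt (W := fun _ => ℂ) U f := by
    filter_upwards [W.isOpen.mem_nhds x.2] with y hy
    rw [zeroExt_of_mem (W := fun _ => ℂ) _ hy, zeroExt_of_mem (W := fun _ => ℂ) _ (h hy)]
    rfl
  have h2 := h1.mfderiv_eq (I := 𝓘(ℂ)) (I' := 𝓘(ℂ))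
  exact ContinuousLinearMap.ext fun u => DFunLike.congr_fun h2 u

end Hol

variable (F : Type*) [NormedAddCommGroup F] [NormedSpace ℂ F]
  (V : X → Type*) [∀ x, AddCommGroup (V x)] [∀ x, Module ℂ (V x)]
  [∀ x, TopologicalSpace (V x)] [TopologicalSpace (TotalSpace F V)]
  [FiberBundle F V] [VectorBundle ℂ F V]

/-- The `𝒪(U)`-module `Γ(U, V)` of holomorphic sections over `U` of the holomorphic vector bundle
`V` with model fibre `F`. -/
structure Sec (U : Opens X) where
  toFun : ∀ x : U, V x
  holo : ContMDiffOn 𝓘(ℂ) (𝓘(ℂ).prod 𝓘(ℂ, F)) ω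
    (fun x => TotalSpace.mk' F x (zeroExt U toFun x)) U

namespace Sec

variable {F V}

instance (U : Opens X) : CoeFun (Sec F V U) (fun _ => ∀ x : U, V x) := ⟨Sec.toFun⟩

@[ext] theorem ext {U : Opens X} {s t : Sec F V U} (h : ∀ x, s x = t x) : s = t := by
  cases s; cases t; congr; exact funext h

instance (U : Opens X) : Zero (Sec F V U) := ⟨⟨fun _ => 0,
  ((contMDiff_zeroSection ℂ V).contMDiffOn).congr fun x hx => by
    simp [zeroExt_of_mem _ hx, zeroSection]⟩⟩
instance (U : Opens X) : Add (Sec F V U) := ⟨fun s t => ⟨fun x => s x + t x,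
  (ContMDiffOn.add_section s.holo t.holo).congr fun x hx => by simp [zeroExt_of_mem _ hx]⟩⟩
instance (U : Opens X) : Neg (Sec F V U) := ⟨fun s => ⟨fun x => - s x,
  (ContMDiffOn.neg_section s.holo).congr fun x hx => by simp [zeroExt_of_mem _ hx]⟩⟩
instance (U : Opens X) : Sub (Sec F V U) := ⟨fun s t => ⟨fun x => s x - t x,
  (ContMDiffOn.sub_section s.holo t.holo).congr fun x hx => by simp [zeroExt_of_mem _ hx]⟩⟩
instance (U : Opens X) : SMul (Hol U) (Sec F V U) := ⟨fun f s => ⟨fun x => f x • s x,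
  (ContMDiffOn.smul_section f.holo s.holo).congr fun x hx => by
    simp [zeroExt_of_mem _ hx]⟩⟩
instance (U : Opens X) : SMul ℂ (Sec F V U) := ⟨fun c s => ⟨fun x => c • s x,
  (ContMDiffOn.const_smul_section (a := c) s.holo).congr fun x hx => by
    simp [zeroExt_of_mem _ hx]⟩⟩

@[simp] theorem add_apply {U : Opens X} (s t : Sec F V U) (x : U) : (s + t) x = s x + t x := rfl
@[simp] theorem sub_apply {U : Opens X} (s t : Sec F V U) (x : U) : (s - t) x = s x - t x := rfl
@[simp] theorem neg_apply {U : Opens X} (s : Sec F V U) (x : U) : (-s) x = -s x := rfl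
@[simp] theorem zero_apply {U : Opens X} (x : U) : (0 : Sec F V U) x = 0 := rfl
@[simp] theorem smul_apply {U : Opens X} (f : Hol U) (s : Sec F V U) (x : U) :
    (f • s) x = f x • s x := rfl
@[simp] theorem csmul_apply {U : Opens X} (c : ℂ) (s : Sec F V U) (x : U) :
    (c • s) x = c • s x := rfl

instance (U : Opens X) : AddCommGroup (Sec F V U) where
  add_assoc f g h := ext fun x => by simp [add_assoc]
  zero_add f := ext fun x => by simp
  add_zero f := ext fun x => by simp
  add_comm f g := ext fun x => by simp [add_comm]
  neg_add_cancel f := ext fun x => by simp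
  sub_eq_add_neg f g := ext fun x => by simp [sub_eq_add_neg]
  nsmul := nsmulRec
  zsmul := zsmulRec

instance (U : Opens X) : Module (Hol U) (Sec F V U) where
  one_smul s := ext fun x => by simp
  mul_smul f g s := ext fun x => by simp [mul_smul]
  smul_zero f := ext fun x => by simp
  smul_add f s t := ext fun x => by simp
  add_smul f g s := ext fun x => by simp [add_smul]
  zero_smul s := ext fun x => by simp

instance (U : Opens X) : Module ℂ (Sec F V U) where
  one_smul s := ext fun x => by simp
  mul_smul f g s := ext fun x => by simp [mul_smul]
  smul_zero f := ext fun x => by simp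
  smul_add f s t := ext fun x => by simp
  add_smul f g s := ext fun x => by simp [add_smul]
  zero_smul s := ext fun x => by simp

/-- Restriction of holomorphic sections. -/
def res {U W : Opens X} (h : W ≤ U) : Sec F V U →ₗ[ℂ] Sec F V W where
  toFun s := ⟨fun x => s ⟨x, h x.2⟩, (s.holo.mono h).congr fun x hx => by
    rw [zeroExt_of_mem _ hx, zeroExt_of_mem _ (h hx)]⟩
  map_add' _ _ := rfl
  map_smul' _ _ := rfl

@[simp] theorem res_apply {U W : Opens X} (h : W ≤ U) (s : Sec F V U) (x : W) :
    s.res h x = s ⟨x, h x.2⟩ := rfl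

/-- Multiplication by a holomorphic function, as a `ℂ`-linear operator. -/
def mulBy {U : Opens X} (f : Hol U) : Module.End ℂ (Sec F V U) where
  toFun s := f • s
  map_add' := smul_add f
  map_smul' c s := ext fun x => by simp [smul_comm c]

@[simp] theorem mulBy_apply {U : Opens X} (f : Hol U) (s : Sec F V U) : mulBy f s = f • s := rfl

end Sec

section Tangent

variable [IsManifold 𝓘(ℂ) ω X]

/-- Holomorphic vector fields on `U`. -/
abbrev VF (U : Opens X) : Type _ := Sec ℂ (fun x : X => TangentSpace 𝓘(ℂ) x) U

theorem contMDiffAt_mvfderiv {f : X → ℂ} {v : ∀ x : X, TangentSpace 𝓘(ℂ) x} {x : X}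
    (hf : ContMDiffAt 𝓘(ℂ) 𝓘(ℂ) ω f x)
    (hv : ContMDiffAt 𝓘(ℂ) (𝓘(ℂ).prod 𝓘(ℂ, ℂ)) ω (fun x => TotalSpace.mk' ℂ x (v x)) x) :
    ContMDiffAt 𝓘(ℂ) 𝓘(ℂ) ω (fun y => mvfderiv 𝓘(ℂ) f y (v y)) x := by
  have h1 := ContMDiffAt.mfderiv_const (m := ω) hf (by simp)
  have h2 := ContMDiffAt.clm_apply_of_inCoordinates (b₁ := id) (b₂ := f) (m₀ := x)
    (ϕ := fun y => mfderiv 𝓘(ℂ) 𝓘(ℂ) f y) (v := v) h1 hv hf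
  exact (contMDiff_snd_tangentBundle_modelSpace ℂ 𝓘(ℂ)).contMDiffAt.comp x h2

/-- The derivative `v(f)` of a holomorphic function along a holomorphic vector field. -/
def VF.deriv {U : Opens X} (v : VF U) (f : Hol U) : Hol U :=
  ⟨fun x => f.d x (v x), fun x hx => by
    refine (ContMDiffAt.congr_of_eventuallyEq (contMDiffAt_mvfderiv
      (f.holo.contMDiffAt (U.isOpen.mem_nhds hx)) (v.holo.contMDiffAt (U.isOpen.mem_nhds hx)))
      ?_).contMDiffWithinAt
    filter_upwards [U.isOpen.mem_nhds hx] with y hy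
    rw [zeroExt_of_mem (W := fun _ => ℂ) _ hy, zeroExt_of_mem _ hy]
    rfl⟩

/-- `Γ(U, TX ⊗ 𝒪(-S))`: the holomorphic vector fields on `U` that vanish at the points of `S`. -/
def logVFSubmodule (S : Finset X) (U : Opens X) : Submodule (Hol U) (VF U) where
  carrier := {v | ∀ x : U, (x : X) ∈ S → v x = 0}
  add_mem' {v w} hv hw x hx := by rw [Sec.add_apply, hv x hx, hw x hx, add_zero]
  zero_mem' x _ := rfl
  smul_mem' f v hv x hx := by rw [Sec.smul_apply, hv x hx, smul_zero]

/-- `Γ(U, TX ⊗ 𝒪(-S))` as a type. -/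
abbrev LogVF (S : Finset X) (U : Opens X) : Type _ := logVFSubmodule S U

/-- Restriction of such vector fields. -/
def LogVF.res {S : Finset X} {U W : Opens X} (h : W ≤ U) (v : LogVF S U) : LogVF S W :=
  ⟨Sec.res h v.1, fun x hx => v.2 ⟨x, h x.2⟩ hx⟩

end Tangent

section Operators

variable {F V}

variable (F V) in
/-- Families of `ℂ`-linear operators `Γ(W, V) → Γ(W, V)`, one for each open `W ⊆ U`. -/
structure Op (U : Opens X) where
  app : ∀ W : Opens X, W ≤ U → Module.End ℂ (Sec F V W)

namespace Op

@[ext] theorem ext {U : Opens X} {P Q : Op F V U} (h : ∀ W hW s, P.app W hW s = Q.app W hW s) :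
    P = Q := by
  cases P; cases Q; congr; funext W hW; exact LinearMap.ext (h W hW)

instance (U : Opens X) : Zero (Op F V U) := ⟨⟨fun _ _ => 0⟩⟩
instance (U : Opens X) : Add (Op F V U) := ⟨fun P Q => ⟨fun W hW => P.app W hW + Q.app W hW⟩⟩
instance (U : Opens X) : Neg (Op F V U) := ⟨fun P => ⟨fun W hW => - P.app W hW⟩⟩
instance (U : Opens X) : SMul (Hol U) (Op F V U) :=
  ⟨fun f P => ⟨fun W hW => Sec.mulBy (f.res hW) * P.app W hW⟩⟩

@[simp] theorem add_app {U : Opens X} (P Q : Op F V U) (W : Opens X) (hW : W ≤ U) :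
    (P + Q).app W hW = P.app W hW + Q.app W hW := rfl
@[simp] theorem neg_app {U : Opens X} (P : Op F V U) (W : Opens X) (hW : W ≤ U) :
    (-P).app W hW = - P.app W hW := rfl
@[simp] theorem zero_app {U : Opens X} (W : Opens X) (hW : W ≤ U) :
    (0 : Op F V U).app W hW = 0 := rfl
@[simp] theorem smul_app {U : Opens X} (f : Hol U) (P : Op F V U) (W : Opens X) (hW : W ≤ U) :
    (f • P).app W hW = Sec.mulBy (f.res hW) * P.app W hW := rfl

instance (U : Opens X) : AddCommGroup (Op F V U) where
  add_assoc f g h := ext fun W hW s => by simp [add_assoc]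
  zero_add f := ext fun W hW s => by simp
  add_zero f := ext fun W hW s => by simp
  add_comm f g := ext fun W hW s => by simp [add_comm]
  neg_add_cancel f := ext fun W hW s => by simp
  nsmul := nsmulRec
  zsmul := zsmulRec

instance (U : Opens X) : Module (Hol U) (Op F V U) where
  one_smul P := ext fun W hW s => Sec.ext fun x => by simp
  mul_smul f g P := ext fun W hW s => Sec.ext fun x => by simp [mul_smul]
  smul_zero f := ext fun W hW s => by simp
  smul_add f P Q := ext fun W hW s => by simp
  add_smul f g P := ext fun W hW s => Sec.ext fun x => by simp [add_smul]
  zero_smul P := ext fun W hW s => Sec.ext fun x => by simp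

/-- Restriction to a smaller open set. -/
def res {U W : Opens X} (h : W ≤ U) (P : Op F V U) : Op F V W :=
  ⟨fun W' hW' => P.app W' (hW'.trans h)⟩

/-- `P` commutes with restrictions, i.e. it is a `ℂ`-linear endomorphism of the sheaf `V|_U`. -/
def IsSheafMap {U : Opens X} (P : Op F V U) : Prop :=
  ∀ (W W' : Opens X) (hW : W ≤ U) (h : W' ≤ W) (s : Sec F V W),
    Sec.res h (P.app W hW s) = P.app W' (h.trans hW) (Sec.res h s)

theorem IsSheafMap.add {U : Opens X} {P Q : Op F V U} (hP : P.IsSheafMap) (hQ : Q.IsSheafMap) :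
    (P + Q).IsSheafMap := fun W W' hW h s => by
  simp [hP W W' hW h s, hQ W W' hW h s]

theorem IsSheafMap.zero {U : Opens X} : (0 : Op F V U).IsSheafMap := fun W W' hW h s => by simp

theorem IsSheafMap.smul {U : Opens X} (f : Hol U) {P : Op F V U} (hP : P.IsSheafMap) :
    (f • P).IsSheafMap := fun W W' hW h s => Sec.ext fun x => by
  simp [← hP W W' hW h s]

end Op

/-- The commutator `[A, f] = A ∘ f - f ∘ A`. -/
def comm {U : Opens X} (A : Module.End ℂ (Sec F V U)) (f : Hol U) : Module.End ℂ (Sec F V U) :=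
  A * Sec.mulBy f - Sec.mulBy f * A

theorem comm_apply {U : Opens X} (A : Module.End ℂ (Sec F V U)) (f : Hol U) (s : Sec F V U) :
    comm A f s = A (f • s) - f • A s := rfl

theorem comm_add {U : Opens X} (A B : Module.End ℂ (Sec F V U)) (f : Hol U) :
    comm (A + B) f = comm A f + comm B f := by
  simp only [comm]; noncomm_ring

theorem comm_zero {U : Opens X} (f : Hol U) : comm (0 : Module.End ℂ (Sec F V U)) f = 0 := by
  simp [comm]

theorem comm_mulBy {U : Opens X} (A : Module.End ℂ (Sec F V U)) (g f : Hol U) :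
    comm (Sec.mulBy g * A) f = Sec.mulBy g * comm A f := by
  have : (Sec.mulBy f * Sec.mulBy g : Module.End ℂ (Sec F V U)) = Sec.mulBy g * Sec.mulBy f :=
    LinearMap.ext fun s => smul_comm f g s
  simp only [comm, mul_sub, ← mul_assoc, this]

variable (F V) in
/-- `Γ(U, Diff¹(V, V))`: the holomorphic differential operators of order at most one from `V|_U`
to itself, i.e. the `ℂ`-linear endomorphisms of the sheaf `V|_U` whose commutators with two
holomorphic functions vanish. -/
def Diff1 (U : Opens X) : Submodule (Hol U) (Op F V U) where
  carrier := {P | P.IsSheafMap ∧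
    ∀ (W : Opens X) (hW : W ≤ U) (f g : Hol W), comm (comm (P.app W hW) f) g = 0}
  add_mem' {P Q} hP hQ := ⟨hP.1.add hQ.1, fun W hW f g => by
    rw [Op.add_app, comm_add, comm_add, hP.2, hQ.2, add_zero]⟩
  zero_mem' := ⟨.zero, fun W hW f g => by rw [Op.zero_app, comm_zero, comm_zero]⟩
  smul_mem' k P hP := ⟨hP.1.smul k, fun W hW f g => by
    rw [Op.smul_app, comm_mulBy, comm_mulBy, hP.2, mul_zero]⟩

variable (F V) in
/-- `Γ(U, End(V))`: the `𝒪_U`-linear endomorphisms of the sheaf `V|_U`. -/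
def Endo (U : Opens X) : Submodule (Hol U) (Op F V U) where
  carrier := {P | P.IsSheafMap ∧ ∀ (W : Opens X) (hW : W ≤ U) (f : Hol W), comm (P.app W hW) f = 0}
  add_mem' {P Q} hP hQ := ⟨hP.1.add hQ.1, fun W hW f => by
    rw [Op.add_app, comm_add, hP.2, hQ.2, add_zero]⟩
  zero_mem' := ⟨.zero, fun W hW f => by rw [Op.zero_app, comm_zero]⟩
  smul_mem' k P hP := ⟨hP.1.smul k, fun W hW f => by
    rw [Op.smul_app, comm_mulBy, hP.2, mul_zero]⟩

/-- The symbol of a first order operator `P`, as the derivation `f ↦ [P, f]` with values in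
endomorphisms; here `End(V) ⊗ TX` is identified with the sheaf of derivations from `𝒪` to
`End(V)`, the section `A ⊗ v` being the derivation `f ↦ v(f) A`. -/
def symbol {U : Opens X} (P : Op F V U) (W : Opens X) (hW : W ≤ U) (f : Hol W) :
    Module.End ℂ (Sec F V W) :=
  comm (P.app W hW) f

variable (F V) in
/-- The section `Id ⊗ v` of `End(V) ⊗ TX`, as the derivation `f ↦ v(f) Id`. -/
def idTensor [IsManifold 𝓘(ℂ) ω X] {U : Opens X} (v : VF U) (W : Opens X) (hW : W ≤ U)
    (f : Hol W) : Module.End ℂ (Sec F V W) :=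
  Sec.mulBy (VF.deriv (Sec.res hW v) f)

variable [IsManifold 𝓘(ℂ) ω X]

theorem idTensor_add {U : Opens X} (v w : VF U) (W : Opens X) (hW : W ≤ U)
    (f : Hol W) : idTensor F V (v + w) W hW f = idTensor F V v W hW f + idTensor F V w W hW f :=
  LinearMap.ext fun s => Sec.ext fun x => by
    change f.d x (v _ + w _) • s x = f.d x (v _) • s x + f.d x (w _) • s x
    rw [map_add, add_smul]

theorem idTensor_smul {U : Opens X} (g : Hol U) (v : VF U) (W : Opens X)
    (hW : W ≤ U) (f : Hol W) :
    idTensor F V (g • v) W hW f = Sec.mulBy (g.res hW) * idTensor F V v W hW f :=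
  LinearMap.ext fun s => Sec.ext fun x => by
    change f.d x (g _ • v _) • s x = g _ • f.d x (v _) • s x
    rw [map_smul, smul_eq_mul, mul_smul]

theorem idTensor_zero {U : Opens X} (W : Opens X)
    (hW : W ≤ U) (f : Hol W) : idTensor F V (0 : VF U) W hW f = 0 :=
  LinearMap.ext fun s => Sec.ext fun x => by
    change f.d x 0 • s x = 0
    rw [map_zero, zero_smul]

end Operators

section Local

variable [IsManifold 𝓘(ℂ) ω X]
variable {F V}

/-- Local coordinates. Near every point there is a holomorphic function vanishing exactly at that
point and with invertible differential there. -/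
theorem exists_coordinate {U : Opens X} {x : X} (hx : x ∈ U) :
    ∃ (W : Opens X) (_ : W ≤ U) (hxW : x ∈ W) (z : Hol W), z ⟨x, hxW⟩ = 0 ∧
      (∀ y : W, z y = 0 → (y : X) = x) ∧ Function.Bijective (z.d ⟨x, hxW⟩) := by
  let φ := chartAt ℂ x
  let W : Opens X := ⟨U ∩ φ.source, U.isOpen.inter φ.open_source⟩
  have hxW : x ∈ W := ⟨hx, mem_chart_source ℂ x⟩
  have hφ : ContMDiffOn 𝓘(ℂ) 𝓘(ℂ) ω φ φ.source := contMDiffOn_chart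
  have hd : MDifferentiableAt 𝓘(ℂ) 𝓘(ℂ) φ x :=
    ((hφ.contMDiffAt (φ.open_source.mem_nhds hxW.2)).mdifferentiableAt (by simp))
  let z : Hol W := ⟨fun y => φ y - φ x, ((hφ.mono Set.inter_subset_right).sub
    (contMDiffOn_const (c := φ x))).congr fun y hy =>
      zeroExt_of_mem (W := fun _ => ℂ) _ hy⟩
  have hz : z.d ⟨x, hxW⟩ = mvfderiv 𝓘(ℂ) φ x := by
    have h1 : zeroExt (W := fun _ => ℂ) W z =ᶠ[nhds x] (φ : X → ℂ) - fun _ => φ x := by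
      filter_upwards [W.isOpen.mem_nhds hxW] with y hy
      exact zeroExt_of_mem (W := fun _ => ℂ) _ hy
    have h2 : z.d ⟨x, hxW⟩ = mvfderiv 𝓘(ℂ) ((φ : X → ℂ) - fun _ => φ x) x := by
      unfold Hol.d mvfderiv
      refine ContinuousLinearMap.ext fun u => ?_
      have := h1.mfderiv_eq (I := 𝓘(ℂ)) (I' := 𝓘(ℂ))
      exact DFunLike.congr_fun this u
    rw [h2, mvfderiv_sub hd mdifferentiableAt_const, mvfderiv_const, sub_zero]
  refine ⟨W, Set.inter_subset_left, hxW, z, sub_self _, fun y hy => ?_, ?_⟩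
  · exact φ.injOn y.2.2 hxW.2 (sub_eq_zero.1 hy)
  · rw [hz]
    exact (mdifferentiable_chart (I := 𝓘(ℂ)) x).mfderiv_bijective hxW.2

/-- Every vector in a fibre is the value of a local holomorphic section. -/
theorem exists_sec [ContMDiffVectorBundle ω F V 𝓘(ℂ)] {U : Opens X} {x : X} (hx : x ∈ U)
    (e : V x) : ∃ (W : Opens X) (_ : W ≤ U) (hxW : x ∈ W) (s : Sec F V W), s ⟨x, hxW⟩ = e := by
  let t := trivializationAt F V x
  let W : Opens X := ⟨U ∩ t.baseSet, U.isOpen.inter t.open_baseSet⟩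
  have hxW : x ∈ W := ⟨hx, FiberBundle.mem_baseSet_trivializationAt' x⟩
  refine ⟨W, Set.inter_subset_left, hxW,
    ⟨fun y => t.symm y (t.continuousLinearMapAt ℂ x e), ?_⟩, ?_⟩
  · have h : ContMDiffOn 𝓘(ℂ) (𝓘(ℂ).prod 𝓘(ℂ, F)) ω
        (fun y => TotalSpace.mk' F y (t.symm y (t.continuousLinearMapAt ℂ x e))) t.baseSet := by
      rw [t.contMDiffOn_section_baseSet_iff]
      refine (contMDiffOn_const (c := t.continuousLinearMapAt ℂ x e)).congr fun y hy => ?_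
      rw [t.mk_symm hy, t.apply_symm_apply' hy]
    exact (h.mono Set.inter_subset_right).congr fun y hy => by rw [zeroExt_of_mem _ hy]
  · change t.symm x _ = e
    rw [← t.symmL_apply (R := ℂ) hxW.2]
    exact t.symmL_continuousLinearMapAt (R := ℂ) hxW.2 e

/-- `TX → End(V) ⊗ TX`, `v ↦ Id ⊗ v`, is injective (the rank of `V` being positive). -/
theorem idTensor_injective [ContMDiffVectorBundle ω F V 𝓘(ℂ)] [Nontrivial F] {U : Opens X} :
    Function.Injective (idTensor F V (U := U)) := by
  intro v w h
  refine Sec.ext fun x => ?_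
  obtain ⟨W, hW, hxW, z, -, -, hd⟩ := exists_coordinate x.2
  have : Nontrivial (V x) := ((trivializationAt F V (x : X)).linearEquivAt ℂ x
    (FiberBundle.mem_baseSet_trivializationAt' _)).toEquiv.nontrivial
  obtain ⟨e, he⟩ := exists_ne (0 : V x)
  obtain ⟨W', hW', hxW', s, hs⟩ := exists_sec (F := F) (V := V) hxW e
  have h1 := congrFun (congrFun (congrFun h W') (hW'.trans hW)) (z.res hW')
  have h2 := congrArg (fun t : Sec F V W' => t ⟨x, hxW'⟩) (DFunLike.congr_fun h1 s)
  change (z.res hW').d ⟨x, hxW'⟩ (v x) • s ⟨x, hxW'⟩ =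
    (z.res hW').d ⟨x, hxW'⟩ (w x) • s ⟨x, hxW'⟩ at h2
  rw [hs, Hol.d_res] at h2
  exact hd.1 (smul_left_injective ℂ he h2)

end Local

section Punctured

theorem nhdsWithin_compl_neBot (x : X) : (nhdsWithin x {x}ᶜ).NeBot := by
  let φ := chartAt ℂ x
  have hx : x ∈ φ.source := mem_chart_source ℂ x
  have h1 : Filter.Tendsto φ.symm (nhdsWithin (φ x) {φ x}ᶜ) (nhdsWithin x {x}ᶜ) := by
    refine tendsto_nhdsWithin_iff.2 ⟨?_, ?_⟩
    · have := (φ.continuousAt_symm (φ.map_source hx)).tendsto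
      rw [φ.left_inv hx] at this
      exact this.mono_left nhdsWithin_le_nhds
    · filter_upwards [nhdsWithin_le_nhds (φ.open_target.mem_nhds (φ.map_source hx)),
        self_mem_nhdsWithin] with y hy hne h
      exact hne (by rw [← φ.right_inv hy, Set.mem_singleton_iff.1 h]; rfl)
  exact Filter.NeBot.mono (f := Filter.map φ.symm (nhdsWithin (φ x) {φ x}ᶜ)) inferInstance h1

variable {F V}

/-- Two sections that are holomorphic at `x` and agree near `x` away from `x` agree at `x`. -/
theorem eq_of_eventuallyEq_punctured {s t : ∀ x, V x} {x : X}
    (hs : ContMDiffAt 𝓘(ℂ) (𝓘(ℂ).prod 𝓘(ℂ, F)) ω (fun y => TotalSpace.mk' F y (s y)) x)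
    (ht : ContMDiffAt 𝓘(ℂ) (𝓘(ℂ).prod 𝓘(ℂ, F)) ω (fun y => TotalSpace.mk' F y (t y)) x)
    (h : ∀ᶠ y in nhdsWithin x {x}ᶜ, s y = t y) : s x = t x := by
  have := nhdsWithin_compl_neBot x
  let e := trivializationAt F V x
  have hx : x ∈ e.baseSet := FiberBundle.mem_baseSet_trivializationAt' x
  rw [contMDiffAt_section] at hs ht
  have h1 := hs.continuousAt.tendsto.mono_left (nhdsWithin_le_nhds (s := {x}ᶜ))
  have h2 := ht.continuousAt.tendsto.mono_left (nhdsWithin_le_nhds (s := {x}ᶜ))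
  have h3 := tendsto_nhds_unique_of_eventuallyEq h1 h2 (by
    filter_upwards [h] with y hy; rw [hy])
  exact (e.linearEquivAt ℂ x hx).injective (by simpa using h3)

/-- If `a s = b t` near a common zero `x` of the functions `a` and `b`, then
`da_x(u) s(x) = db_x(u) t(x)`. -/
theorem deriv_smul_eq [ContMDiffVectorBundle ω F V 𝓘(ℂ)] {s t : ∀ x, V x} {a b : X → ℂ} {x : X}
    (hs : ContMDiffAt 𝓘(ℂ) (𝓘(ℂ).prod 𝓘(ℂ, F)) ω (fun y => TotalSpace.mk' F y (s y)) x)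
    (ht : ContMDiffAt 𝓘(ℂ) (𝓘(ℂ).prod 𝓘(ℂ, F)) ω (fun y => TotalSpace.mk' F y (t y)) x)
    (ha : ContMDiffAt 𝓘(ℂ) 𝓘(ℂ) ω a x) (hb : ContMDiffAt 𝓘(ℂ) 𝓘(ℂ) ω b x)
    (ha0 : a x = 0) (hb0 : b x = 0) (h : ∀ᶠ y in nhds x, a y • s y = b y • t y)
    (u : TangentSpace 𝓘(ℂ) x) :
    mvfderiv 𝓘(ℂ) a x u • s x = mvfderiv 𝓘(ℂ) b x u • t x := by
  let e := trivializationAt F V x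
  have hx : x ∈ e.baseSet := FiberBundle.mem_baseSet_trivializationAt' x
  rw [contMDiffAt_section] at hs ht
  set A : X → F := fun y => (e ⟨y, s y⟩).2 with hA
  set B : X → F := fun y => (e ⟨y, t y⟩).2 with hB
  have hAB : a • A =ᶠ[nhds x] b • B := by
    filter_upwards [h, e.open_baseSet.mem_nhds hx] with y hy hye
    have := congrArg (e.linearEquivAt ℂ y hye) hy
    simpa [hA, hB] using this
  have hd := hAB.mfderiv_eq (I := 𝓘(ℂ)) (I' := 𝓘(ℂ, F))
  have hd' : mvfderiv 𝓘(ℂ) (a • A) x u = mvfderiv 𝓘(ℂ) (b • B) x u :=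
    DFunLike.congr_fun hd u
  rw [mvfderiv_smul (ha.mdifferentiableAt (by simp)) (hs.mdifferentiableAt (by simp)),
    mvfderiv_smul (hb.mdifferentiableAt (by simp)) (ht.mdifferentiableAt (by simp)), ha0, hb0] at hd'
  apply (e.linearEquivAt ℂ x hx).injective
  simpa [hA, hB] using hd'

end Punctured

section LogForms

variable [T2Space X] [IsManifold 𝓘(ℂ) ω X]

/-- `U ∖ S`, as an open set. -/
def off (S : Finset X) (U : Opens X) : Opens X :=
  ⟨(U : Set X) \ S, U.isOpen.sdiff S.finite_toSet.isClosed⟩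

theorem off_le (S : Finset X) (U : Opens X) : off S U ≤ U := fun _ h => h.1

theorem off_mono {S : Finset X} {U W : Opens X} (h : W ≤ U) : off S W ≤ off S U :=
  fun _ hx => ⟨h hx.1, hx.2⟩

variable [∀ x, IsTopologicalAddGroup (V x)] [∀ x, ContinuousSMul ℂ (V x)]

/-- `Γ(U, V ⊗ K_X)`: the holomorphic sections over `U` of `Hom(TX, V)`. -/
abbrev Form (U : Opens X) : Type _ :=
  Sec (ℂ →L[ℂ] F) (fun x : X => TangentSpace 𝓘(ℂ) x →L[ℂ] V x) U

variable {F V} in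
/-- The form `η` on `W` is the product `z ω`, for a function `z` on `W` and a form `ω` on `U ∖ S`
(equality being required on `W ∖ S`). -/
def IsMul {S : Finset X} {U W : Opens X} (h : W ≤ U) (z : Hol W) (w : Form F V (off S U))
    (η : Form F V W) : Prop :=
  ∀ (y : X) (hy : y ∈ off S W), η ⟨y, hy.1⟩ = z ⟨y, hy.1⟩ • w ⟨y, off_mono h hy⟩

/-- `Γ(U, V ⊗ K_X ⊗ 𝒪(S))`: the `V`-valued one-forms on `U` with at most simple poles, located
at points of `S`. These are the holomorphic forms `w` on `U ∖ S` such that `z w` extends to a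
holomorphic form whenever `z` is a local function vanishing on `S`. -/
def LogForm (S : Finset X) (U : Opens X) : Submodule ℂ (Form F V (off S U)) where
  carrier := {w | ∀ (W : Opens X) (h : W ≤ U) (z : Hol W), (∀ y : W, (y : X) ∈ S → z y = 0) →
    ∃ η : Form F V W, IsMul h z w η}
  add_mem' {w w'} hw hw' W h z hz := by
    obtain ⟨η, hη⟩ := hw W h z hz
    obtain ⟨η', hη'⟩ := hw' W h z hz
    exact ⟨η + η', fun y hy => by
      rw [Sec.add_apply, Sec.add_apply, hη y hy, hη' y hy, smul_add]⟩
  zero_mem' W h z hz := ⟨0, fun y hy => by rw [Sec.zero_apply, Sec.zero_apply, smul_zero]⟩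
  smul_mem' c w hw W h z hz := by
    obtain ⟨η, hη⟩ := hw W h z hz
    exact ⟨c • η, fun y hy => by
      rw [Sec.csmul_apply, Sec.csmul_apply, hη y hy, smul_comm]⟩

/-- A logarithmic connection on `V`, singular over `S`: a `ℂ`-linear sheaf homomorphism
`V → V ⊗ K_X ⊗ 𝒪(S)` satisfying the Leibniz identity `D(fs) = f D(s) + s ⊗ df`. -/
structure LogConnection (S : Finset X) where
  toFun : ∀ U : Opens X, Sec F V U →ₗ[ℂ] LogForm F V S U
  map_res : ∀ {U W : Opens X} (h : W ≤ U) (s : Sec F V U),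
    (toFun W (s.res h)).1 = (toFun U s).1.res (off_mono h)
  leibniz : ∀ {U : Opens X} (f : Hol U) (s : Sec F V U) (x : X) (hx : x ∈ off S U),
    (toFun U (f • s)).1 ⟨x, hx⟩ = f ⟨x, hx.1⟩ • (toFun U s).1 ⟨x, hx⟩ +
      (f.d ⟨x, hx.1⟩).smulRight (s ⟨x, hx.1⟩)

variable {F V}

/-- The image of the logarithmic form `w` under
`(V ⊗ K_X ⊗ 𝒪(S))_x ≅ V_x`, `(dz / z)(x) ⊗ c ↦ c`, is `c`: if `z` is a function near `x` that
vanishes on `S`, then `z w` takes the value `dz_x ⊗ c` at `x`. -/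
def HasPolarValue {S : Finset X} {U : Opens X} (w : LogForm F V S U) {x : X} (c : V x) : Prop :=
  ∀ (W : Opens X) (h : W ≤ U) (hx : x ∈ W) (z : Hol W), (∀ y : W, (y : X) ∈ S → z y = 0) →
    ∀ η : Form F V W, IsMul h z w.1 η → η ⟨x, hx⟩ = (z.d ⟨x, hx⟩).smulRight c

/-- The linear map `R` is the residue of `D` at `x`: for every local section `s` near `x`, the
composite `V → V ⊗ K_X ⊗ 𝒪(S) → (V ⊗ K_X ⊗ 𝒪(S))_x ≅ V_x` maps `s` to `R (s x)`. -/
def LogConnection.IsResidue {S : Finset X} (D : LogConnection F V S) (x : X)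
    (R : V x →ₗ[ℂ] V x) : Prop :=
  ∀ (U : Opens X) (hx : x ∈ U) (s : Sec F V U), HasPolarValue (D.toFun U s) (R (s ⟨x, hx⟩))

/-- A local coordinate at `x` whose domain contains no point of `S` other than, possibly, `x`. -/
theorem exists_log_coordinate {S : Finset X} {U : Opens X} {x : X} (hx : x ∈ U) :
    ∃ (W : Opens X) (_ : W ≤ U) (hxW : x ∈ W) (z : Hol W), z ⟨x, hxW⟩ = 0 ∧
      (∀ y : W, (y : X) ∈ S → z y = 0) ∧ (∀ y : W, z y = 0 → (y : X) = x) ∧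
      Function.Bijective (z.d ⟨x, hxW⟩) := by
  classical
  let U' : Opens X := off (S.erase x) U
  have hx' : x ∈ U' := ⟨hx, by simp⟩
  obtain ⟨W, h, hxW, z, hz, hinj, hd⟩ := exists_coordinate hx'
  refine ⟨W, h.trans (off_le _ _), hxW, z, hz, fun y hy => ?_, hinj, hd⟩
  have : (y : X) = x := by
    by_contra hne
    exact (h y.2).2 (by simpa [hne] using hy)
  obtain ⟨y, hyW⟩ := y
  subst this
  exact hz

theorem eventually_mem_off {S : Finset X} {W : Opens X} {x : X} (hx : x ∈ W) :
    ∀ᶠ y in nhdsWithin x {x}ᶜ, y ∈ off S W := by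
  classical
  have h : x ∈ off (S.erase x) W := ⟨hx, by simp⟩
  filter_upwards [nhdsWithin_le_nhds ((off (S.erase x) W).isOpen.mem_nhds h),
    self_mem_nhdsWithin] with y hy hne
  exact ⟨hy.1, fun hS => hy.2 (Finset.mem_coe.2 (Finset.mem_erase.2 ⟨hne, hS⟩))⟩

theorem Hol.contMDiffAt {U : Opens X} (f : Hol U) {x : X} (hx : x ∈ U) :
    ContMDiffAt 𝓘(ℂ) 𝓘(ℂ) ω (zeroExt (W := fun _ => ℂ) U f) x :=
  f.holo.contMDiffAt (U.isOpen.mem_nhds hx)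

theorem Sec.contMDiffAt {U : Opens X} (s : Sec F V U) {x : X} (hx : x ∈ U) :
    ContMDiffAt 𝓘(ℂ) (𝓘(ℂ).prod 𝓘(ℂ, F)) ω (fun y => TotalSpace.mk' F y (zeroExt U s y)) x :=
  s.holo.contMDiffAt (U.isOpen.mem_nhds hx)

variable [ContMDiffVectorBundle ω F V 𝓘(ℂ)]

theorem exists_hasPolarValue {S : Finset X} {U : Opens X} (w : LogForm F V S U) {x : X}
    (hx : x ∈ U) (hxS : x ∈ S) : ∃ c : V x, HasPolarValue w c := by
  obtain ⟨W₀, h₀, hx₀, z₀, hz₀, hzS₀, -, hd₀⟩ := exists_log_coordinate (S := S) hx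
  obtain ⟨η₀, hη₀⟩ := w.2 W₀ h₀ z₀ hzS₀
  obtain ⟨u₀, hu₀⟩ := hd₀.2 1
  refine ⟨η₀ ⟨x, hx₀⟩ u₀, fun W h hxW z hzS η hη => ?_⟩
  have key := deriv_smul_eq (η₀.contMDiffAt hx₀) (η.contMDiffAt hxW) (z.contMDiffAt hxW)
    (z₀.contMDiffAt hx₀) (by rw [zeroExt_of_mem (W := fun _ => ℂ) _ hxW]; exact hzS ⟨x, hxW⟩ hxS)
    (by rw [zeroExt_of_mem (W := fun _ => ℂ) _ hx₀]; exact hz₀) (by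
      have h1 := eventually_nhdsWithin_iff.1 (eventually_mem_off (S := S) hxW)
      filter_upwards [h1, W.isOpen.mem_nhds hxW, W₀.isOpen.mem_nhds hx₀] with y hy hyW hyW₀
      rw [zeroExt_of_mem (W := fun _ => ℂ) _ hyW, zeroExt_of_mem (W := fun _ => ℂ) _ hyW₀,
        zeroExt_of_mem _ hyW, zeroExt_of_mem _ hyW₀]
      by_cases hyx : y = x
      · subst hyx
        rw [hzS ⟨y, hxW⟩ hxS, hz₀, zero_smul, zero_smul]
      · have hyo := hy hyx
        rw [hη y hyo, hη₀ y ⟨hyW₀, hyo.2⟩, smul_comm])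
  simp only [zeroExt_of_mem _ hxW, zeroExt_of_mem _ hx₀] at key
  refine ContinuousLinearMap.ext fun u => ?_
  have e1 : η ⟨x, hxW⟩ = z.d ⟨x, hxW⟩ u₀ • η₀ ⟨x, hx₀⟩ := by
    have := key u₀
    change z.d ⟨x, hxW⟩ u₀ • η₀ ⟨x, hx₀⟩ = z₀.d ⟨x, hx₀⟩ u₀ • η ⟨x, hxW⟩ at this
    rw [this, hu₀, one_smul]
  have hu : u = z₀.d ⟨x, hx₀⟩ u • u₀ := hd₀.1 (by
    rw [map_smul, hu₀, smul_eq_mul, mul_one])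
  rw [e1]
  change z.d ⟨x, hxW⟩ u₀ • η₀ ⟨x, hx₀⟩ u = z.d ⟨x, hxW⟩ u • η₀ ⟨x, hx₀⟩ u₀
  rw [hu, map_smul, map_smul, smul_eq_mul, smul_smul, mul_comm]

/-- The contraction of a form with a vector field. -/
def contract {U : Opens X} (η : Form F V U) (v : VF U) : Sec F V U :=
  ⟨fun x => η x (v x), fun x hx => by
    refine (ContMDiffAt.congr_of_eventuallyEq (ContMDiffAt.clm_bundle_apply
      (η.contMDiffAt hx) (v.contMDiffAt hx)) ?_).contMDiffWithinAt
    filter_upwards [U.isOpen.mem_nhds hx] with y hy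
    rw [zeroExt_of_mem _ hy, zeroExt_of_mem _ hy, zeroExt_of_mem _ hy]⟩

theorem Sec.sum_apply {U : Opens X} {ι : Type*} (t : Finset ι) (s : ι → Sec F V U) (x : U) :
    (∑ i ∈ t, s i) x = ∑ i ∈ t, s i x :=
  map_sum (AddMonoidHom.mk' (fun s : Sec F V U => s x) (fun _ _ => rfl)) s t

/-- Local frames. -/
theorem exists_frame [FiniteDimensional ℂ F] (x : X) :
    ∃ (n : ℕ) (W : Opens X) (_ : x ∈ W) (e : Fin n → Sec F V W) (κ : Fin n → V x →ₗ[ℂ] ℂ),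
      ∀ (U : Opens X) (hx : x ∈ U) (s : Sec F V U), ∃ (W' : Opens X) (h : W' ≤ U) (h' : W' ≤ W)
        (hx' : x ∈ W') (f : Fin n → Hol W'), s.res h = ∑ i, f i • (e i).res h' ∧
          ∀ i, f i ⟨x, hx'⟩ = κ i (s ⟨x, hx⟩) := by
  have : ContMDiffVectorBundle 1 F V 𝓘(ℂ) := .of_le (n := ω) (by simp)
  let t := trivializationAt F V x
  let b := Module.finBasis ℂ F
  let W : Opens X := ⟨t.baseSet, t.open_baseSet⟩
  have hx : x ∈ W := FiberBundle.mem_baseSet_trivializationAt' x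
  refine ⟨_, W, hx, fun i => ⟨fun y => t.localFrame b i y,
    (t.contMDiffOn_localFrame_baseSet (I := 𝓘(ℂ)) ω b i).congr fun y hy => by
      rw [zeroExt_of_mem _ hy]⟩, fun i => t.localFrameCoeff 𝓘(ℂ) b i x, fun U hxU s => ?_⟩
  refine ⟨U ⊓ W, inf_le_left, inf_le_right, ⟨hxU, hx⟩, fun i =>
    ⟨fun y => t.localFrameCoeff 𝓘(ℂ) b i y (s ⟨y, y.2.1⟩), fun y hy => ?_⟩, ?_, fun i => rfl⟩
  · refine (ContMDiffAt.congr_of_eventuallyEq (contMDiffAt_localFrameCoeff b hy.2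
      (s.contMDiffAt hy.1) i) ?_).contMDiffWithinAt
    filter_upwards [(U ⊓ W).isOpen.mem_nhds hy] with y hy
    rw [zeroExt_of_mem (W := fun _ => ℂ) _ hy]
    simp [LinearMap.piApply, zeroExt_of_mem _ hy.1, t]
  · ext y
    rw [Sec.sum_apply]
    have := t.eq_sum_localFrameCoeff_smul (I := 𝓘(ℂ)) (b := b) (s := zeroExt U s) y.2.2
    rw [zeroExt_of_mem _ y.2.1] at this
    exact this

/-- The residue exists. -/
theorem LogConnection.exists_isResidue [FiniteDimensional ℂ F] {S : Finset X}
    (D : LogConnection F V S) (x : S) : ∃ R : V x →ₗ[ℂ] V x, D.IsResidue x R := by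
  obtain ⟨n, W₁, hx₁, e, κ, H⟩ := exists_frame (F := F) (V := V) (x : X)
  choose c hc using fun i => exists_hasPolarValue (D.toFun W₁ (e i)) hx₁ x.2
  refine ⟨∑ i, (κ i).smulRight (c i), fun U hxU s W hWU hxW z hz η hη => ?_⟩
  obtain ⟨W', h, h', hx', f, hs, hf⟩ := H U hxU s
  refine ContinuousLinearMap.ext fun u => ?_
  obtain ⟨W₂, hW₂, hx₂, v, hv⟩ := exists_sec (F := ℂ) (V := fun y : X => TangentSpace 𝓘(ℂ) y)
    (U := W ⊓ W') ⟨hxW, hx'⟩ u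
  have a1 : W₂ ≤ W := hW₂.trans inf_le_left
  have a2 : W₂ ≤ W' := hW₂.trans inf_le_right
  have hz₂ : ∀ y : W₂, (y : X) ∈ S → z.res a1 y = 0 := fun y hy => hz _ hy
  choose θ hθ using fun i => (D.toFun W₁ (e i)).2 W₂ (a2.trans h') (z.res a1) hz₂
  have key := eq_of_eventuallyEq_punctured (contract (Sec.res a1 η) v |>.contMDiffAt hx₂)
    (∑ i, ((f i).res a2 • contract (θ i) v +
      (z.res a1 * VF.deriv v ((f i).res a2)) • (e i).res (a2.trans h')) |>.contMDiffAt hx₂) (by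
      filter_upwards [eventually_mem_off (S := S) hx₂] with y hy
      rw [zeroExt_of_mem _ hy.1, zeroExt_of_mem _ hy.1, Sec.sum_apply]
      have b1 : (D.toFun U s).1 ⟨y, off_mono (a1.trans hWU) hy⟩ =
          ∑ i, (f i ⟨y, a2 hy.1⟩ • (D.toFun W₁ (e i)).1 ⟨y, off_mono (a2.trans h') hy⟩ +
            ((f i).d ⟨y, a2 hy.1⟩).smulRight (e i ⟨y, h' (a2 hy.1)⟩)) := by
        have b2 : (D.toFun W' (s.res h)).1 ⟨y, off_mono a2 hy⟩ =
          (D.toFun U s).1 ⟨y, off_mono (a1.trans hWU) hy⟩ := by rw [D.map_res]; rfl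
        rw [← b2, hs, map_sum, AddSubmonoidClass.coe_finsetSum, Sec.sum_apply]
        refine Finset.sum_congr rfl fun i _ => ?_
        rw [D.leibniz, D.map_res]
        rfl
      change η ⟨y, a1 hy.1⟩ (v ⟨y, hy.1⟩) = _
      rw [hη y (off_mono a1 hy), b1, Finset.smul_sum, sum_apply]
      refine Finset.sum_congr rfl fun i _ => ?_
      have hd : VF.deriv v ((f i).res a2) ⟨y, hy.1⟩ = (f i).d ⟨y, a2 hy.1⟩ (v ⟨y, hy.1⟩) := by
        exact DFunLike.congr_fun (Hol.d_res a2 (f i) ⟨y, hy.1⟩) _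
      change _ = f i ⟨y, a2 hy.1⟩ • θ i ⟨y, hy.1⟩ (v ⟨y, hy.1⟩) +
        (z ⟨y, a1 hy.1⟩ * VF.deriv v ((f i).res a2) ⟨y, hy.1⟩) • e i ⟨y, h' (a2 hy.1)⟩
      rw [hθ i y hy, hd]
      rw [mul_smul]
      have e1 : ∀ (a b : ℂ) (A : TangentSpace 𝓘(ℂ) y →L[ℂ] V y) (l : TangentSpace 𝓘(ℂ) y →L[ℂ] ℂ)
          (p : V y) (u : TangentSpace 𝓘(ℂ) y),
          (a • (b • A + l.smulRight p)) u = b • (a • A) u + a • l u • p := by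
        intro a b A l p u
        simp only [smul_apply, add_apply, ContinuousLinearMap.smulRight_apply, smul_add]
        rw [smul_comm a b]
      exact e1 _ _ _ _ _ _)
  rw [zeroExt_of_mem _ hx₂, zeroExt_of_mem _ hx₂, Sec.sum_apply] at key
  have c1 : η ⟨x, hxW⟩ u = contract (Sec.res a1 η) v ⟨x, hx₂⟩ := by
    rw [← hv]; rfl
  rw [c1, key]
  have hzx : z ⟨x, hxW⟩ = 0 := hz _ x.2
  have hdz : (z.res a1).d ⟨x, hx₂⟩ = z.d ⟨x, hxW⟩ := Hol.d_res a1 z ⟨x, hx₂⟩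
  have c2 : ∀ i, ((f i).res a2 • contract (θ i) v +
      (z.res a1 * VF.deriv v ((f i).res a2)) • (e i).res (a2.trans h')) ⟨x, hx₂⟩ =
        κ i (s ⟨x, hxU⟩) • z.d ⟨x, hxW⟩ u • c i := by
    intro i
    have := hc i W₂ (a2.trans h') hx₂ (z.res a1) hz₂ (θ i) (hθ i)
    change f i ⟨x, hx'⟩ • θ i ⟨x, hx₂⟩ (v ⟨x, hx₂⟩) + (z ⟨x, hxW⟩ * _) • _ = _
    rw [this, hzx, zero_mul, zero_smul, add_zero, hf, hv, hdz]
    rfl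
  rw [Finset.sum_congr rfl fun i _ => c2 i]
  change _ = z.d ⟨x, hxW⟩ u • (∑ i, (κ i).smulRight (c i)) (s ⟨x, hxU⟩)
  rw [LinearMap.sum_apply, Finset.smul_sum]
  exact Finset.sum_congr rfl fun i _ => smul_comm _ _ _

/-- The residue `Res(D, x) : V_x → V_x` of a logarithmic connection at a point `x` of `S`. -/
def LogConnection.residue [FiniteDimensional ℂ F] {S : Finset X}
    (D : LogConnection F V S) (x : S) : V x →ₗ[ℂ] V x :=
  (D.exists_isResidue x).choose

theorem LogConnection.isResidue_residue [FiniteDimensional ℂ F] {S : Finset X}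
    (D : LogConnection F V S) (x : S) : D.IsResidue x (D.residue x) :=
  (D.exists_isResidue x).choose_spec

/-- The residue is the only linear map with its defining property. -/
theorem LogConnection.IsResidue.unique {S : Finset X} {D : LogConnection F V S} {x : X}
    {R R' : V x →ₗ[ℂ] V x} (h : D.IsResidue x R) (h' : D.IsResidue x R') : R = R' := by
  refine LinearMap.ext fun e => ?_
  obtain ⟨U, -, hxU, s, hs⟩ := exists_sec (F := F) (V := V) (U := ⊤) (x := x) trivial e
  obtain ⟨W, hW, hxW, z, -, hz, -, hd⟩ := exists_log_coordinate (S := S) hxU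
  obtain ⟨η, hη⟩ := (D.toFun U s).2 W hW z hz
  obtain ⟨u, hu⟩ := hd.2 1
  have h1 := h U hxU s W hW hxW z hz η hη
  have h2 := h' U hxU s W hW hxW z hz η hη
  have h3 := DFunLike.congr_fun (h1.symm.trans h2) u
  change z.d ⟨x, hxW⟩ u • R _ = z.d ⟨x, hxW⟩ u • R' _ at h3
  rw [hu, one_smul, one_smul, hs] at h3
  exact h3

end LogForms

section Parabolic

/-- A parabolic structure over the finite set `S` on the bundle `V`: for each `x ∈ S`, a
decreasing filtration `V_x = E_{x,1} ⊇ ⋯ ⊇ E_{x,l} ⊇ E_{x,l+1} = 0` of the fibre by subspaces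
and weights `0 ≤ α_{x,1} < ⋯ < α_{x,l} < 1`. Indices are shifted by one: `flag x 0` is the
whole fibre. -/
structure ParabolicStructure (S : Finset X) where
  len : S → ℕ
  flag : ∀ x : S, Fin (len x + 1) → Submodule ℂ (V x)
  flag_antitone : ∀ x, Antitone (flag x)
  flag_zero : ∀ x, flag x 0 = ⊤
  flag_last : ∀ x, flag x (Fin.last (len x)) = ⊥
  weight : ∀ x : S, Fin (len x) → ℝ
  weight_strictMono : ∀ x, StrictMono (weight x)
  weight_nonneg : ∀ x j, 0 ≤ weight x j
  weight_lt_one : ∀ x j, weight x j < 1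

namespace ParabolicStructure

variable {F V} {S : Finset X} (E : ParabolicStructure V S)

variable (F) in
/-- `Γ(U, ℰ_{x,j})`, where `ℰ_{x,j}` is the kernel of `V → V_x / E_{x,j}`. -/
def subsheaf (x : S) (j : Fin (E.len x + 1)) (U : Opens X) : Submodule (Hol U) (Sec F V U) where
  carrier := {s | ∀ h : (x : X) ∈ U, s ⟨x, h⟩ ∈ E.flag x j}
  add_mem' hs ht h := add_mem (hs h) (ht h)
  zero_mem' _ := zero_mem _
  smul_mem' f _ hs h := Submodule.smul_mem _ (f ⟨x, h⟩) (hs h)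

/-- `P` maps `ℰ_{x,j}|_U` into itself for all `x ∈ S` and `1 ≤ j ≤ l_x`. -/
def Preserves {U : Opens X} (P : Op F V U) : Prop :=
  ∀ (W : Opens X) (hW : W ≤ U) (x : S) (j : Fin (E.len x)) (s : Sec F V W),
    s ∈ E.subsheaf F x j.castSucc W → P.app W hW s ∈ E.subsheaf F x j.castSucc W

theorem Preserves.add {U : Opens X} {P Q : Op F V U} (hP : E.Preserves P) (hQ : E.Preserves Q) :
    E.Preserves (P + Q) := fun W hW x j s hs =>
  add_mem (hP W hW x j s hs) (hQ W hW x j s hs)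

theorem Preserves.zero {U : Opens X} : E.Preserves (0 : Op F V U) := fun _ _ _ _ _ _ => zero_mem _

theorem Preserves.smul {U : Opens X} (f : Hol U) {P : Op F V U} (hP : E.Preserves P) :
    E.Preserves (f • P) := fun W hW x j s hs =>
  Submodule.smul_mem _ (f.res hW) (hP W hW x j s hs)

variable (F) in
/-- `Γ(U, End^P(E_*))`. -/
def EndP (U : Opens X) : Submodule (Hol U) (Op F V U) where
  carrier := {P | P ∈ Endo F V U ∧ E.Preserves P}
  add_mem' hP hQ := ⟨add_mem hP.1 hQ.1, hP.2.add E hQ.2⟩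
  zero_mem' := ⟨zero_mem _, Preserves.zero E⟩
  smul_mem' f _ hP := ⟨Submodule.smul_mem _ f hP.1, hP.2.smul E f⟩

variable (F) in
/-- `Γ(U, Diff¹_P(V, V))`. -/
def Diff1P (U : Opens X) : Submodule (Hol U) (Op F V U) where
  carrier := {P | P ∈ Diff1 F V U ∧ E.Preserves P}
  add_mem' hP hQ := ⟨add_mem hP.1 hQ.1, hP.2.add E hQ.2⟩
  zero_mem' := ⟨zero_mem _, Preserves.zero E⟩
  smul_mem' f _ hP := ⟨Submodule.smul_mem _ f hP.1, hP.2.smul E f⟩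

variable [IsManifold 𝓘(ℂ) ω X]

variable (F) in
/-- `Γ(U, At(E_*))`: the operators in `Diff¹_P(V, V)` whose symbol lies in the subsheaf
`TX ⊗ 𝒪(-S) = Id ⊗ TX ⊗ 𝒪(-S)` of `End(V) ⊗ TX`. -/
def At (U : Opens X) : Submodule (Hol U) (Op F V U) where
  carrier := {P | P ∈ E.Diff1P F U ∧ ∃ v : LogVF S U, symbol P = idTensor F V v.1}
  add_mem' := by
    rintro P Q ⟨hP, v, hv⟩ ⟨hQ, w, hw⟩
    refine ⟨add_mem hP hQ, v + w, ?_⟩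
    funext W hW f
    have h1 := congrFun (congrFun (congrFun hv W) hW) f
    have h2 := congrFun (congrFun (congrFun hw W) hW) f
    change _ = idTensor F V (v.1 + w.1) W hW f
    rw [idTensor_add, ← h1, ← h2]
    exact comm_add _ _ _
  zero_mem' := by
    refine ⟨zero_mem _, 0, ?_⟩
    funext W hW f
    change _ = idTensor F V 0 W hW f
    rw [idTensor_zero]
    exact comm_zero _
  smul_mem' := by
    rintro g P ⟨hP, v, hv⟩
    refine ⟨Submodule.smul_mem _ g hP, g • v, ?_⟩
    funext W hW f
    have h1 := congrFun (congrFun (congrFun hv W) hW) f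
    change _ = idTensor F V (g • v.1) W hW f
    rw [idTensor_smul, ← h1]
    exact comm_mulBy _ _ _

variable [ContMDiffVectorBundle ω F V 𝓘(ℂ)] [Nontrivial F]

variable (F) in
/-- The projection `σ : At(E_*) → TX ⊗ 𝒪(-S)` of the Atiyah sequence: the restriction of the
symbol map, i.e. `σ(P) = v` where `v` is the vector field with symbol `Id ⊗ v`. -/
def sigma (U : Opens X) : E.At F U →ₗ[Hol U] LogVF S U where
  toFun P := P.2.2.choose
  map_add' P Q := Subtype.ext <| idTensor_injective (F := F) (V := V) <| by
    rw [← (P + Q).2.2.choose_spec]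
    funext W hW f
    change _ = idTensor F V (P.2.2.choose.1 + Q.2.2.choose.1) W hW f
    rw [idTensor_add, ← P.2.2.choose_spec, ← Q.2.2.choose_spec]
    exact comm_add _ _ _
  map_smul' g P := Subtype.ext <| idTensor_injective (F := F) (V := V) <| by
    rw [← (g • P).2.2.choose_spec]
    funext W hW f
    change _ = idTensor F V (g • P.2.2.choose.1) W hW f
    rw [idTensor_smul, ← P.2.2.choose_spec]
    exact comm_mulBy _ _ _

theorem symbol_eq {U : Opens X} (P : E.At F U) :
    symbol P.1 = idTensor F V (E.sigma F U P).1 := P.2.2.choose_spec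

/-- The kernel of `σ` is `End^P(E_*)`. -/
theorem sigma_eq_zero_iff {U : Opens X} (P : E.At F U) :
    E.sigma F U P = 0 ↔ P.1 ∈ E.EndP F U := by
  constructor
  · intro h
    refine ⟨⟨P.2.1.1.1, fun W hW f => ?_⟩, P.2.1.2⟩
    have := congrFun (congrFun (congrFun (E.symbol_eq P) W) hW) f
    rw [h] at this
    exact this.trans (idTensor_zero W hW f)
  · intro h
    refine Subtype.ext <| idTensor_injective (F := F) (V := V) ?_
    rw [← E.symbol_eq]
    funext W hW f
    exact (h.1.2 W hW f).trans (idTensor_zero W hW f).symm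

variable (F) in
/-- A holomorphic splitting of the Atiyah sequence
`0 → End^P(E_*) → At(E_*) → TX ⊗ 𝒪(-S) → 0`: an `𝒪_X`-linear homomorphism
`h : TX ⊗ 𝒪(-S) → At(E_*)` with `σ ∘ h = Id`. -/
structure Splitting where
  toFun : ∀ U : Opens X, LogVF S U →ₗ[Hol U] E.At F U
  map_res : ∀ {U W : Opens X} (h : W ≤ U) (v : LogVF S U),
    (toFun W (v.res h)).1 = (toFun U v).1.res h
  sigma_comp : ∀ U : Opens X, E.sigma F U ∘ₗ toFun U = LinearMap.id

variable [T2Space X] [∀ x, IsTopologicalAddGroup (V x)] [∀ x, ContinuousSMul ℂ (V x)]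

/-- The logarithmic connection `D` is the one associated to the splitting `h`: the contraction of
`D(s)` with a vector field `v` is `h(v)(s)`. (Contractions are compared on `U ∖ S`.) -/
def Splitting.IsAssociated {E : ParabolicStructure V S} (h : E.Splitting F)
    (D : LogConnection F V S) : Prop :=
  ∀ (U : Opens X) (v : LogVF S U) (s : Sec F V U) (x : X) (hx : x ∈ off S U),
    (D.toFun U s).1 ⟨x, hx⟩ (v.1 ⟨x, hx.1⟩) = (h.toFun U v).1.app U le_rfl s ⟨x, hx.1⟩

variable [FiniteDimensional ℂ F]

/-- `Res(D, x)(E_{x,j}) ⊆ E_{x,j}` for all `x ∈ S` and all `j`. -/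
def PreservesFlags (D : LogConnection F V S) : Prop :=
  ∀ (x : S) (j : Fin (E.len x + 1)), ∀ e ∈ E.flag x j, D.residue x e ∈ E.flag x j

/-- The graded piece `E_{x,j} / E_{x,j+1}`. -/
abbrev Gr (x : S) (j : Fin (E.len x)) : Type _ :=
  E.flag x j.castSucc ⧸ (E.flag x j.succ).submoduleOf (E.flag x j.castSucc)

/-- The endomorphism of `E_{x,j} / E_{x,j+1}` induced by `Res(D, x)`. -/
def grResidue {D : LogConnection F V S} (hD : E.PreservesFlags D) (x : S) (j : Fin (E.len x)) :
    E.Gr x j →ₗ[ℂ] E.Gr x j :=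
  Submodule.mapQ _ _ ((D.residue x).restrict (hD x j.castSucc)) fun e he => hD x j.succ e he

/-- A connection on the parabolic bundle `E_*`: a logarithmic connection whose residues preserve
the flags and induce multiplication by `α_{x,j}` on `E_{x,j} / E_{x,j+1}`. -/
structure IsConnection (D : LogConnection F V S) : Prop where
  preservesFlags : E.PreservesFlags D
  grResidue_eq : ∀ (x : S) (j : Fin (E.len x)),
    E.grResidue preservesFlags x j = (E.weight x j : ℂ) • LinearMap.id

end ParabolicStructure

end Parabolic

end Sections
end ParabolicBundle

end

open ParabolicBundle

noncomputable section

namespace ParabolicBundle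

variable {X : Type*} [TopologicalSpace X] [ChartedSpace ℂ X]
variable {F : Type*} [NormedAddCommGroup F] [NormedSpace ℂ F]
  {V : X → Type*} [∀ x, AddCommGroup (V x)] [∀ x, Module ℂ (V x)]
  [∀ x, TopologicalSpace (V x)] [TopologicalSpace (TotalSpace F V)]
  [FiberBundle F V] [VectorBundle ℂ F V]

/-! A splitting `h` and a logarithmic connection `D` are two ways of writing one pairing `(v, s) ↦
h(v)(s) = ⟨D(s), v⟩`, which is `𝒪`-linear in `v` and satisfies the Leibniz rule in `s`: the
condition `σ ∘ h = Id` says exactly that `[h(v), f] = v(f)`.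

From `h` to `D`: an `𝒪`-linear, restriction-compatible map on vector fields is contraction with a
form (`exists_form`). Off `S` every field lies in `TX ⊗ 𝒪(-S)`, so `v ↦ h(v)(s)` is a form `D(s)`
there. If `z` vanishes on `S`, then `v ↦ h(zv)(s)` makes sense for all `v`, also at `S`, and is a
holomorphic extension of `z D(s)`; so the poles are at most simple (`connectionForm_mem`). For a
coordinate `z` at `x ∈ S` and `dz(v) = 1` at `x`, the value of `h(zv)(s)` at `x` is `Res(D,
x)(s(x))`. Since `h(zv)` preserves each `ℰ_{x,j}`, the residue preserves `E_{x,j}`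
(`Splitting.IsAssociated.preservesFlags`).

From `D` to `h`: locally `v = z p` with `z` vanishing on `S`, so `⟨D(s), v⟩ = ⟨z D(s), p⟩` extends
across `S`, with value a multiple of `Res(D, x)(s(x))` at `x ∈ S`. Hence the operator preserves the
`ℰ_{x,j}` as soon as the residues preserve the flags.

Each of `h` and `D` determines the other because holomorphic sections that agree off `S` are equal
(`Sec.ext_off`). The weight condition concerns `D` alone and is carried along unchanged. -/

/-- The inverse of a nowhere vanishing holomorphic function. -/
def Hol.inv {U : Opens X} (f : Hol U) (hf : ∀ x, f x ≠ 0) : Hol U :=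
  ⟨fun x => (f x)⁻¹, by
    have h0 : ∀ x ∈ U, zeroExt (W := fun _ => ℂ) U f x ≠ 0 := fun x hx => by
      rw [zeroExt_of_mem (W := fun _ => ℂ) _ hx]; exact hf _
    refine (ContMDiffOn.inv₀ f.holo h0).congr fun x hx => ?_
    rw [zeroExt_of_mem (W := fun _ => ℂ) _ hx, zeroExt_of_mem (W := fun _ => ℂ) _ hx]⟩

/-! ### Coordinate vector fields, and forms as `𝒪`-linear maps on vector fields -/

section VectorFields

variable [IsManifold 𝓘(ℂ) ω X]

/-- Local coordinates with their coordinate vector field: near every point there are a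
holomorphic function `z` and a vector field `∂` with `dz(∂) = 1`. -/
theorem exists_coordinate_vectorField [T2Space X] {U : Opens X} {x : X} (hx : x ∈ U) :
    ∃ (W : Opens X) (_ : W ≤ U) (_ : x ∈ W) (z : Hol W) (p : VF W), ∀ y, z.d y (p y) = 1 := by
  obtain ⟨W₁, h₁, hx₁, z, -, -, hd⟩ := exists_coordinate hx
  obtain ⟨u, hu⟩ := hd.2 1
  obtain ⟨W₂, h₂, hx₂, v, hv⟩ :=
    exists_sec (F := ℂ) (V := fun y : X => TangentSpace 𝓘(ℂ) y) hx₁ u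
  -- `dz(v)` equals 1 only at `x`; it is nonzero on a neighbourhood, where dividing `v` by it
  -- normalises the field.
  let g : Hol W₂ := VF.deriv v (z.res h₂)
  have hgx : g ⟨x, hx₂⟩ = 1 := by
    change (z.res h₂).d ⟨x, hx₂⟩ (v ⟨x, hx₂⟩) = 1
    rw [hv, Hol.d_res, hu]
  have hev : ∀ᶠ y in nhds x, zeroExt (W := fun _ => ℂ) W₂ g y ≠ 0 := by
    refine (g.contMDiffAt hx₂).continuousAt.eventually_ne ?_
    rw [zeroExt_of_mem (W := fun _ => ℂ) _ hx₂]
    exact hgx.trans_ne one_ne_zero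
  obtain ⟨O, hO, hOo, hxO⟩ := eventually_nhds_iff.1 hev
  let W₃ : Opens X := W₂ ⊓ ⟨O, hOo⟩
  have h₃ : W₃ ≤ W₂ := inf_le_left
  have hg : ∀ y : W₃, g.res h₃ y ≠ 0 := fun y => by
    have := hO y y.2.2
    rwa [zeroExt_of_mem (W := fun _ => ℂ) _ (h₃ y.2)] at this
  refine ⟨W₃, h₃.trans (h₂.trans h₁), ⟨hx₂, hxO⟩, z.res (h₃.trans h₂),
    (g.res h₃).inv hg • v.res h₃, fun y => ?_⟩
  have e1 : (z.res (h₃.trans h₂)).d y = (z.res h₂).d ⟨y, h₃ y.2⟩ :=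
    (Hol.d_res (h₃.trans h₂) z y).trans (Hol.d_res h₂ z ⟨y, h₃ y.2⟩).symm
  rw [e1]
  change (z.res h₂).d ⟨y, h₃ y.2⟩ ((g.res h₃ y)⁻¹ • v ⟨y, h₃ y.2⟩) = 1
  rw [map_smul]
  exact inv_mul_cancel₀ (hg y)

/-- In dimension one, `l w = w * l 1` for all `w`, hence `l u * p = u * l p = u`. It is stated over
`ℂ` because each tangent space unfolds to `ℂ`. -/
theorem eq_smul_of_apply_eq_one {l : ℂ →L[ℂ] ℂ} {p : ℂ} (h : l p = 1) (u : ℂ) :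
    u = l u • p := by
  have e : ∀ w, l w = w * l 1 := fun w => by
    rw [← smul_eq_mul, ← map_smul, smul_eq_mul, mul_one]
  rw [e] at h
  rw [e, smul_eq_mul, mul_assoc, mul_comm (l 1), h, mul_one]

/-- A vector field is the multiple of the coordinate vector field by the derivative of the
coordinate. -/
theorem VF.eq_deriv_smul {U : Opens X} {z : Hol U} {p : VF U} (h : ∀ y, z.d y (p y) = 1)
    (v : VF U) : v = VF.deriv v z • p :=
  Sec.ext fun y => eq_smul_of_apply_eq_one (h y) (v y)

section Forms

variable [∀ x, IsTopologicalAddGroup (V x)] [∀ x, ContinuousSMul ℂ (V x)]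

/-- A `V`-valued one-form is holomorphic if its value on a constant local frame of `TX` is. -/
theorem contMDiffAt_form {η : ∀ x : X, TangentSpace 𝓘(ℂ) x →L[ℂ] V x} {x : X}
    (h : ContMDiffAt 𝓘(ℂ) (𝓘(ℂ).prod 𝓘(ℂ, F)) ω (fun y => TotalSpace.mk' F y
      (η y ((trivializationAt ℂ (fun y : X => TangentSpace 𝓘(ℂ) y) x).symm y 1))) x) :
    ContMDiffAt 𝓘(ℂ) (𝓘(ℂ).prod 𝓘(ℂ, ℂ →L[ℂ] F)) ω
      (fun y => TotalSpace.mk' (ℂ →L[ℂ] F) (E := fun y : X => TangentSpace 𝓘(ℂ) y →L[ℂ] V y)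
        y (η y)) x := by
  rw [contMDiffAt_section] at h
  refine contMDiffAt_hom_bundle _ |>.2 ⟨contMDiffAt_id, ?_⟩
  -- A linear map out of `ℂ` is `t ↦ t • c` with `c` its value at 1, and it depends continuously and
  -- linearly on `c`. In the trivializations at `x`, `c` is the coordinate of the section assumed
  -- holomorphic.
  have h1 := (ContinuousLinearMap.contMDiff (n := ω)
    (ContinuousLinearMap.smulRightL ℂ ℂ F (1 : ℂ →L[ℂ] ℂ))).contMDiffAt.comp x h
  refine h1.congr_of_eventuallyEq ?_
  filter_upwards [(trivializationAt ℂ (fun y : X => TangentSpace 𝓘(ℂ) y) x).open_baseSet.mem_nhds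
    (FiberBundle.mem_baseSet_trivializationAt' x),
    (trivializationAt F V x).open_baseSet.mem_nhds
    (FiberBundle.mem_baseSet_trivializationAt' x)] with y hy hy'
  refine ContinuousLinearMap.ext_ring ?_
  change ContinuousLinearMap.inCoordinates ℂ (fun y : X => TangentSpace 𝓘(ℂ) y) F V x y x y
    (η y) 1 = _
  rw [ContinuousLinearMap.inCoordinates_eq hy hy']
  change _ = (1 : ℂ) • (trivializationAt F V x ⟨y, η y
    ((trivializationAt ℂ (fun y : X => TangentSpace 𝓘(ℂ) y) x).symm y 1)⟩).2
  rw [one_smul]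
  rfl

/-- A map from vector fields to sections of `V` that is compatible with restrictions and with
multiplication by functions is the contraction with a unique form. -/
theorem exists_form [T2Space X] {U : Opens X} (A : ∀ W : Opens X, W ≤ U → VF W → Sec F V W)
    (hres : ∀ (W W' : Opens X) (h : W ≤ U) (h' : W' ≤ W) (v : VF W),
      A W' (h'.trans h) (Sec.res h' v) = (A W h v).res h')
    (hsmul : ∀ (W : Opens X) (h : W ≤ U) (f : Hol W) (v : VF W), A W h (f • v) = f • A W h v) :
    ∃ η : Form F V U, ∀ (W : Opens X) (h : W ≤ U) (v : VF W) (y : W),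
      η ⟨y, h y.2⟩ (v y) = A W h v y := by
  choose N hNU hN z p hp using fun x : U => exists_coordinate_vectorField x.2
  -- At each point, `η = dz ⊗ A(∂)` for a coordinate `z` and field `∂` chosen for that point alone.
  -- That the choices do not matter is `key`: on the overlap `v = dz(v) ∂`, and `A` is local and
  -- `𝒪`-linear.
  let η : ∀ x : U, TangentSpace 𝓘(ℂ) (x : X) →L[ℂ] V x := fun x =>
    ((z x).d ⟨x, hN x⟩).smulRight (A (N x) (hNU x) (p x) ⟨x, hN x⟩)
  have key : ∀ (W : Opens X) (h : W ≤ U) (v : VF W) (y : W),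
      η ⟨y, h y.2⟩ (v y) = A W h v y := by
    intro W h v y
    let x : U := ⟨y, h y.2⟩
    let O : Opens X := W ⊓ N x
    have hyO : (y : X) ∈ O := ⟨y.2, hN x⟩
    have a1 : O ≤ W := inf_le_left
    have a2 : O ≤ N x := inf_le_right
    have hp' : ∀ t : O, ((z x).res a2).d t (Sec.res a2 (p x) t) = 1 := fun t => by
      rw [Hol.d_res]; exact hp x _
    have e1 := congrArg (fun s : Sec F V O => s ⟨y, hyO⟩) (hres W O h a1 v)
    have e2 := congrArg (fun s : Sec F V O => s ⟨y, hyO⟩) (hres (N x) O (hNU x) a2 (p x))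
    rw [VF.eq_deriv_smul hp' (Sec.res a1 v), hsmul] at e1
    change VF.deriv (Sec.res a1 v) ((z x).res a2) ⟨y, hyO⟩ •
      A O _ (Sec.res a2 (p x)) ⟨y, hyO⟩ = A W h v y at e1
    change A O _ (Sec.res a2 (p x)) ⟨y, hyO⟩ = A (N x) (hNU x) (p x) ⟨y, hN x⟩ at e2
    rw [e2] at e1
    rw [← e1]
    have e3 : VF.deriv (Sec.res a1 v) ((z x).res a2) ⟨y, hyO⟩ = (z x).d ⟨y, hN x⟩ (v y) :=
      DFunLike.congr_fun (Hol.d_res a2 (z x) ⟨y, hyO⟩) _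
    rw [e3]
    rfl
  -- The choices vary with the point without any regularity, so holomorphy comes from `key`: on the
  -- constant field of the tangent trivialization, `η` takes the value of a section produced by `A`.
  refine ⟨⟨η, fun x hx => (contMDiffAt_form ?_).contMDiffWithinAt⟩, key⟩
  let t := trivializationAt ℂ (fun y : X => TangentSpace 𝓘(ℂ) y) x
  let W : Opens X := U ⊓ ⟨t.baseSet, t.open_baseSet⟩
  have hxW : x ∈ W := ⟨hx, FiberBundle.mem_baseSet_trivializationAt' x⟩
  have hf : ContMDiffOn 𝓘(ℂ) (𝓘(ℂ).prod 𝓘(ℂ, ℂ)) ω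
      (fun y => TotalSpace.mk' ℂ y (t.symm y (1 : ℂ))) t.baseSet := by
    rw [t.contMDiffOn_section_baseSet_iff]
    refine (contMDiffOn_const (c := (1 : ℂ))).congr fun y hy => ?_
    rw [t.mk_symm hy, t.apply_symm_apply' hy]
  let v : VF W := ⟨fun y => t.symm y (1 : ℂ), (hf.mono Set.inter_subset_right).congr
    fun y hy => by rw [zeroExt_of_mem _ hy]⟩
  refine ((A W inf_le_left v).contMDiffAt hxW).congr_of_eventuallyEq ?_
  filter_upwards [W.isOpen.mem_nhds hxW] with y hy
  rw [zeroExt_of_mem _ hy, zeroExt_of_mem _ hy.1, ← key]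

end Forms

end VectorFields

/-! ### Identity principles for forms, sections and connections -/

section Extensionality

variable [IsManifold 𝓘(ℂ) ω X]

/-- Linear maps on a tangent space are determined by their values on local vector fields. -/
theorem tangent_clm_ext {U : Opens X} {x : X} (hx : x ∈ U)
    {a b : TangentSpace 𝓘(ℂ) x →L[ℂ] V x}
    (h : ∀ (W : Opens X) (_ : W ≤ U) (hxW : x ∈ W) (v : VF W), a (v ⟨x, hxW⟩) = b (v ⟨x, hxW⟩)) :
    a = b := by
  refine ContinuousLinearMap.ext fun u => ?_
  obtain ⟨W, hW, hxW, v, rfl⟩ :=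
    exists_sec (F := ℂ) (V := fun y : X => TangentSpace 𝓘(ℂ) y) hx u
  exact h W hW hxW v

variable [T2Space X] {S : Finset X}
variable [∀ x, IsTopologicalAddGroup (V x)] [∀ x, ContinuousSMul ℂ (V x)]

/-- Sections that agree off `S` are equal. -/
theorem Sec.ext_off {U : Opens X} {s t : Sec F V U}
    (h : ∀ (x : X) (hx : x ∈ off S U), s ⟨x, hx.1⟩ = t ⟨x, hx.1⟩) : s = t := by
  refine Sec.ext fun ⟨x, hx⟩ => ?_
  have := eq_of_eventuallyEq_punctured (s.contMDiffAt hx) (t.contMDiffAt hx) (by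
    filter_upwards [eventually_mem_off (S := S) hx] with y hy
    rw [zeroExt_of_mem _ hy.1, zeroExt_of_mem _ hy.1, h y hy])
  rwa [zeroExt_of_mem _ hx, zeroExt_of_mem _ hx] at this

theorem LogConnection.toFun_res (D : LogConnection F V S) {U W : Opens X} (h : W ≤ U)
    (s : Sec F V U) (x : X) (hx : x ∈ off S W) :
    (D.toFun W (s.res h)).1 ⟨x, hx⟩ = (D.toFun U s).1 ⟨x, off_mono h hx⟩ := by
  rw [D.map_res]; rfl

theorem LogConnection.ext_apply {D D' : LogConnection F V S}
    (h : ∀ (U : Opens X) (s : Sec F V U) (x : X) (hx : x ∈ off S U),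
      (D.toFun U s).1 ⟨x, hx⟩ = (D'.toFun U s).1 ⟨x, hx⟩) : D = D' := by
  have e : D.toFun = D'.toFun := funext fun U => LinearMap.ext fun s =>
    Subtype.ext (Sec.ext fun x => h U s x x.2)
  cases D; cases D'; cases e; rfl

end Extensionality

/-- The product of a vector field with a function that vanishes on `S`. -/
def LogVF.ofMul [IsManifold 𝓘(ℂ) ω X] {S : Finset X} {U : Opens X} (z : Hol U)
    (hz : ∀ y : U, (y : X) ∈ S → z y = 0) (v : VF U) : LogVF S U :=
  ⟨z • v, fun y hy => by rw [Sec.smul_apply, hz y hy, zero_smul]⟩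

/-- A vector field on an open set that does not meet `S`. -/
def LogVF.ofOff [T2Space X] [IsManifold 𝓘(ℂ) ω X] {S : Finset X} {U W : Opens X}
    (hW : W ≤ off S U) (v : VF W) : LogVF S W :=
  ⟨v, fun y hy => absurd hy (hW y.2).2⟩

/-! ### From a splitting to its logarithmic connection -/

namespace ParabolicStructure

variable {S : Finset X} {E : ParabolicStructure V S}
variable [IsManifold 𝓘(ℂ) ω X] [ContMDiffVectorBundle ω F V 𝓘(ℂ)] [Nontrivial F]

namespace Splitting

variable (h : E.Splitting F)

/-- The section `h(v)(s)`. -/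
def act {U : Opens X} (v : LogVF S U) (s : Sec F V U) : Sec F V U :=
  (h.toFun U v).1.app U le_rfl s

/-- Two compatibilities combine: each `h(v)` is a sheaf map, and `h` itself commutes with
restriction of `v`. -/
theorem act_res {U W : Opens X} (hW : W ≤ U) (v : LogVF S U) (s : Sec F V U) :
    (h.act v s).res hW = h.act (v.res hW) (s.res hW) := by
  have h1 := (h.toFun U v).2.1.1.1 U W le_rfl hW s
  unfold act
  rw [h1, h.map_res]
  rfl

theorem app_eq_act {U W : Opens X} (hW : W ≤ U) (v : LogVF S U) (s : Sec F V W) :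
    (h.toFun U v).1.app W hW s = h.act (v.res hW) s := by
  unfold act
  rw [h.map_res]
  rfl

theorem act_smul_left {U : Opens X} (f : Hol U) (v : LogVF S U) (s : Sec F V U) :
    h.act (f • v) s = f • h.act v s := by
  unfold act
  rw [map_smul]
  rfl

/-- Since `σ(h(v)) = v`, the symbol of `h(v)` is `Id ⊗ v`, which means that its commutator with `f`
is multiplication by `v(f)`. -/
theorem act_leibniz {U : Opens X} (v : LogVF S U) (f : Hol U) (s : Sec F V U) :
    h.act v (f • s) = f • h.act v s + VF.deriv v.1 f • s := by
  have h1 := congrFun (congrFun (congrFun (E.symbol_eq (h.toFun U v)) U) le_rfl) f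
  have h2 : E.sigma F U (h.toFun U v) = v := DFunLike.congr_fun (h.sigma_comp U) v
  rw [h2] at h1
  have h3 : h.act v (f • s) - f • h.act v s = VF.deriv v.1 f • s := DFunLike.congr_fun h1 s
  rw [← h3, add_sub_cancel]

theorem act_mem_subsheaf {U : Opens X} (v : LogVF S U) {x : S} {j : Fin (E.len x)}
    {s : Sec F V U} (hs : s ∈ E.subsheaf F x j.castSucc U) :
    h.act v s ∈ E.subsheaf F x j.castSucc U :=
  (h.toFun U v).2.1.2 U le_rfl x j s hs

variable [T2Space X] [∀ x, IsTopologicalAddGroup (V x)] [∀ x, ContinuousSMul ℂ (V x)]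

/-- The form `v ↦ h(zv)(s)`, where `z` is a function vanishing on `S`. -/
theorem exists_form_ofMul {U : Opens X} (z : Hol U) (hz : ∀ y : U, (y : X) ∈ S → z y = 0)
    (s : Sec F V U) : ∃ η : Form F V U, ∀ (W : Opens X) (hW : W ≤ U) (v : VF W) (y : W),
      η ⟨y, hW y.2⟩ (v y) =
        h.act (.ofMul (z.res hW) (fun y => hz ⟨y, hW y.2⟩) v) (s.res hW) y := by
  refine exists_form (fun W hW v =>
    h.act (.ofMul (z.res hW) (fun y => hz ⟨y, hW y.2⟩) v) (s.res hW)) ?_ ?_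
  · intro W W' hW hW' v
    rw [h.act_res]
    rfl
  · intro W hW f v
    rw [← h.act_smul_left]
    refine congrArg (fun w => h.act w (s.res hW)) (Subtype.ext ?_)
    exact smul_comm _ f v

/-- This is `exists_form_ofMul` with `z = 1`, which is allowed over `off S U` because vanishing on
`S` is vacuous there. -/
theorem exists_connectionForm {U : Opens X} (s : Sec F V U) :
    ∃ η : Form F V (off S U), ∀ (W : Opens X) (hW : W ≤ off S U) (v : LogVF S W) (y : W),
      η ⟨y, hW y.2⟩ (v.1 y) = h.act v (s.res (hW.trans (off_le S U))) y := by
  obtain ⟨η, hη⟩ := h.exists_form_ofMul (1 : Hol (off S U)) (fun y hy => absurd hy y.2.2)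
    (s.res (off_le S U))
  refine ⟨η, fun W hW v y => ?_⟩
  rw [hη]
  refine congrArg (fun w => h.act w _ y) (Subtype.ext ?_)
  exact one_smul (Hol W) v.1

/-- The form `v ↦ h(v)(s)` on the complement of `S`. -/
def connectionForm {U : Opens X} (s : Sec F V U) : Form F V (off S U) :=
  (h.exists_connectionForm s).choose

theorem connectionForm_apply {U : Opens X} (s : Sec F V U) {W : Opens X} (hW : W ≤ off S U)
    (v : LogVF S W) {y : X} (hy : y ∈ W) :
    h.connectionForm s ⟨y, hW hy⟩ (v.1 ⟨y, hy⟩) =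
      h.act v (s.res (hW.trans (off_le S U))) ⟨y, hy⟩ :=
  (h.exists_connectionForm s).choose_spec W hW v ⟨y, hy⟩

/-- Off `S` the fields in `TX ⊗ 𝒪(-S)` attain every tangent vector, so they suffice to test
equality. Linearity, restriction and the Leibniz rule for the connection are all checked through
this criterion. -/
theorem connectionForm_ext {U : Opens X} {s : Sec F V U} {y : X} (hy : y ∈ off S U)
    {a : TangentSpace 𝓘(ℂ) y →L[ℂ] V y}
    (ha : ∀ (W : Opens X) (hW : W ≤ off S U) (hyW : y ∈ W) (v : LogVF S W),
      a (v.1 ⟨y, hyW⟩) = h.act v (s.res (hW.trans (off_le S U))) ⟨y, hyW⟩) :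
    a = h.connectionForm s ⟨y, hy⟩ := by
  refine tangent_clm_ext hy fun W hW hyW v => ?_
  exact (ha W hW hyW (.ofOff hW v)).trans (h.connectionForm_apply s hW (.ofOff hW v) hyW).symm

/-- The form `v ↦ h(zv)(s)` is holomorphic also at `S`, because `zv` vanishes there. Off `S` the
factor `z` can be pulled out of `h`, so this form extends `z` times the connection form: the poles
are at most simple. -/
theorem connectionForm_mem {U : Opens X} (s : Sec F V U) :
    h.connectionForm s ∈ LogForm F V S U := by
  intro W hW z hz
  obtain ⟨η, hη⟩ := h.exists_form_ofMul z hz (s.res hW)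
  refine ⟨η, fun y hy => tangent_clm_ext hy fun W' hW' hyW' v => ?_⟩
  have a1 := hη W' (hW'.trans (off_le S W)) v ⟨y, hyW'⟩
  have a2 := h.connectionForm_apply s (hW'.trans (off_mono hW)) (.ofOff hW' v) hyW'
  have a3 : h.act (.ofMul (z.res (hW'.trans (off_le S W))) (fun y => hz ⟨y, off_le S W (hW' y.2)⟩) v)
      ((s.res hW).res (hW'.trans (off_le S W))) = z.res (hW'.trans (off_le S W)) •
        h.act (.ofOff hW' v) (s.res ((hW'.trans (off_le S W)).trans hW)) :=
    h.act_smul_left _ (.ofOff hW' v) _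
  rw [a3] at a1
  refine a1.trans ?_
  change _ = z ⟨y, hy.1⟩ • h.connectionForm s ⟨y, _⟩ (v ⟨y, hyW'⟩)
  exact congrArg (fun w => z ⟨y, hy.1⟩ • w) a2.symm

/-- The logarithmic connection associated to a splitting of the Atiyah sequence. -/
def connection : LogConnection F V S where
  toFun U :=
    { toFun s := ⟨h.connectionForm s, h.connectionForm_mem s⟩
      map_add' s t := Subtype.ext <| Sec.ext fun y => Eq.symm <|
        h.connectionForm_ext y.2 fun W hW hyW v => by
          change h.connectionForm s _ _ + h.connectionForm t _ _ = _
          rw [h.connectionForm_apply s hW v hyW, h.connectionForm_apply t hW v hyW, map_add]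
          unfold act
          rw [map_add]
          rfl
      map_smul' c s := Subtype.ext <| Sec.ext fun y => Eq.symm <|
        h.connectionForm_ext y.2 fun W hW hyW v => by
          change c • h.connectionForm s _ _ = _
          rw [h.connectionForm_apply s hW v hyW, map_smul]
          unfold act
          rw [map_smul]
          rfl }
  map_res {U W} hW s := Sec.ext fun y => Eq.symm <|
    h.connectionForm_ext y.2 fun W' hW' hyW v =>
      h.connectionForm_apply s (hW'.trans (off_mono hW)) v hyW
  leibniz {U} f s x hx := Eq.symm <|
    h.connectionForm_ext hx fun W hW hxW v => by
      have e : (f • s).res (hW.trans (off_le S U)) =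
          f.res (hW.trans (off_le S U)) • s.res (hW.trans (off_le S U)) := rfl
      rw [e, h.act_leibniz]
      change f ⟨x, hx.1⟩ • h.connectionForm s ⟨x, hx⟩ (v.1 ⟨x, hxW⟩) +
        f.d ⟨x, hx.1⟩ (v.1 ⟨x, hxW⟩) • s ⟨x, hx.1⟩ =
        f ⟨x, hx.1⟩ • h.act v _ ⟨x, hxW⟩ + (f.res (hW.trans (off_le S U))).d ⟨x, hxW⟩
          (v.1 ⟨x, hxW⟩) • s ⟨x, hx.1⟩
      rw [Hol.d_res, h.connectionForm_apply s hW v hxW]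

theorem isAssociated_connection : h.IsAssociated h.connection := fun U v s x hx => by
  refine (h.connectionForm_apply s le_rfl (v.res (off_le S U)) hx).trans ?_
  rw [← h.act_res]
  rfl

-- Connections commute with restriction, so the values of `D(s)` may be tested on small open sets
-- avoiding `S`. There, association prescribes them on every tangent vector.
variable {h} in
theorem IsAssociated.eq_connection {D : LogConnection F V S} (hD : h.IsAssociated D) :
    D = h.connection :=
  LogConnection.ext_apply fun U s x hx => h.connectionForm_ext hx fun W hW hxW v => by
    have h1 := hD W v (s.res (hW.trans (off_le S U))) x ⟨hxW, hx.2⟩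
    exact (DFunLike.congr_fun (D.toFun_res (hW.trans (off_le S U)) s x ⟨hxW, hx.2⟩).symm _).trans h1

variable {h} in
/-- The splitting is determined by the connection associated to it. -/
theorem IsAssociated.ext {h' : E.Splitting F} {D : LogConnection F V S} (hD : h.IsAssociated D)
    (hD' : h'.IsAssociated D) : h = h' := by
  have e : h.toFun = h'.toFun := funext fun U => LinearMap.ext fun v => Subtype.ext <|
    Op.ext fun W hW s => by
      rw [h.app_eq_act, h'.app_eq_act]
      -- Association prescribes `h(v)(s)` only off `S`; the identity principle gives the values at
      -- `S`.
      exact Sec.ext_off (S := S) fun x hx =>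
        (hD W (v.res hW) s x hx).symm.trans (hD' W (v.res hW) s x hx)
  cases h; cases h'; cases e; rfl

variable {h} in
/-- The residues of the connection associated to a splitting preserve the flags. -/
theorem IsAssociated.preservesFlags [FiniteDimensional ℂ F] {D : LogConnection F V S}
    (hD : h.IsAssociated D) : E.PreservesFlags D := by
  intro x j e he
  -- `Preserves` covers the indices up to `l_x` only; the remaining subspace is zero.
  induction j using Fin.lastCases with
  | last =>
    rw [E.flag_last, Submodule.mem_bot] at he
    rw [he, map_zero]
    exact zero_mem _
  | cast j =>
    obtain ⟨U, -, hxU, s, rfl⟩ := exists_sec (F := F) (V := V) (U := ⊤) (x := x) trivial e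
    obtain ⟨W, hW, hxW, z, hz0, hz, -, hd⟩ := exists_log_coordinate (S := S) hxU
    obtain ⟨u, hu⟩ := hd.2 1
    obtain ⟨W', hW', hxW', v, rfl⟩ :=
      exists_sec (F := ℂ) (V := fun y : X => TangentSpace 𝓘(ℂ) y) hxW u
    have hz' : ∀ y : W', (y : X) ∈ S → z.res hW' y = 0 := fun y => hz ⟨y, hW' y.2⟩
    obtain ⟨η, hη⟩ := (D.toFun U s).2 W' (hW'.trans hW) (z.res hW') hz'
    have h1 := D.isResidue_residue x U hxU s W' (hW'.trans hW) hxW' (z.res hW') hz' η hη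
    -- Here `η` extends `z D(s)`, so off `S` both sides are `⟨D(s), zv⟩`; being holomorphic, they
    -- agree at `x` as well.
    have h2 : contract η v = h.act (.ofMul (z.res hW') hz' v) (s.res (hW'.trans hW)) :=
      Sec.ext_off (S := S) fun y hy => by
        refine Eq.trans ?_ (hD W' (.ofMul (z.res hW') hz' v) (s.res (hW'.trans hW)) y hy)
        rw [D.toFun_res]
        change η ⟨y, hy.1⟩ (v ⟨y, hy.1⟩) =
          (D.toFun U s).1 ⟨y, _⟩ (z.res hW' ⟨y, hy.1⟩ • v ⟨y, hy.1⟩)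
        rw [hη y hy, map_smul]
        rfl
    -- The value of `z D(s)` at `x` is `dz ⊗ Res(D, x)(s(x))`, and `v` was chosen with `dz(v) = 1`
    -- at `x`.
    have h3 : contract η v ⟨x, hxW'⟩ = D.residue x (s ⟨x, hxU⟩) := by
      change η ⟨x, hxW'⟩ (v ⟨x, hxW'⟩) = _
      rw [h1]
      change (z.res hW').d ⟨x, hxW'⟩ (v ⟨x, hxW'⟩) • D.residue x (s ⟨x, hxU⟩) = _
      rw [Hol.d_res, hu, one_smul]
    rw [← h3, h2]
    exact h.act_mem_subsheaf _ (x := x) (j := j) (s := s.res (hW'.trans hW))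
      (fun _ => he) hxW'

end Splitting

end ParabolicStructure

/-! ### Contraction of logarithmic forms with fields vanishing on `S` -/

section Contraction

variable [T2Space X] [IsManifold 𝓘(ℂ) ω X]
  [∀ x, IsTopologicalAddGroup (V x)] [∀ x, ContinuousSMul ℂ (V x)] {S : Finset X}

/-- A section given off `S` extends to a holomorphic section if it does so locally. -/
theorem Sec.exists_extension {U : Opens X} (g : ∀ y : off S U, V y)
    (h : ∀ x ∈ U, ∃ (W : Opens X) (hW : W ≤ U) (_ : x ∈ W) (t : Sec F V W),
      ∀ (y : X) (hy : y ∈ off S W), t ⟨y, hy.1⟩ = g ⟨y, off_mono hW hy⟩) :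
    ∃ t : Sec F V U, ∀ (y : X) (hy : y ∈ off S U), t ⟨y, hy.1⟩ = g ⟨y, hy⟩ := by
  choose N hNU hN t ht using fun x : U => h x x.2
  refine ⟨⟨fun x => t x ⟨x, hN x⟩, fun x hx => ?_⟩, fun y hy => ht ⟨y, hy.1⟩ y ⟨hN _, hy.2⟩⟩
  refine (((t ⟨x, hx⟩).contMDiffAt (hN ⟨x, hx⟩)).congr_of_eventuallyEq ?_).contMDiffWithinAt
  filter_upwards [(N ⟨x, hx⟩).isOpen.mem_nhds (hN ⟨x, hx⟩)] with y hy
  have hyU : y ∈ U := hNU _ hy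
  -- The value at `y` comes from the extension chosen for `y`, not for `x`. Both extensions restrict
  -- to `g` off `S`, so they coincide on the overlap.
  let O : Opens X := N ⟨x, hx⟩ ⊓ N ⟨y, hyU⟩
  have e : (t ⟨x, hx⟩).res (inf_le_left : O ≤ _) = (t ⟨y, hyU⟩).res (inf_le_right : O ≤ _) :=
    Sec.ext_off (S := S) fun q hq =>
      (ht ⟨x, hx⟩ q ⟨hq.1.1, hq.2⟩).trans (ht ⟨y, hyU⟩ q ⟨hq.1.2, hq.2⟩).symm
  have e' := congrArg (fun r : Sec F V O => r ⟨y, hy, hN ⟨y, hyU⟩⟩) e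
  rw [zeroExt_of_mem _ hyU, zeroExt_of_mem _ hy]
  exact congrArg _ e'.symm

/-- A vector field vanishing on `S` is locally the product of a function vanishing on `S` with a
nowhere vanishing vector field. -/
theorem LogVF.exists_local_factor {U : Opens X} (v : LogVF S U) {x : X} (hx : x ∈ U) :
    ∃ (W : Opens X) (hW : W ≤ U) (_ : x ∈ W) (z : Hol W) (p : VF W),
      (∀ y : W, (y : X) ∈ S → z y = 0) ∧ Sec.res hW v.1 = z • p := by
  obtain ⟨W, hW, hxW, q, p, hp⟩ := exists_coordinate_vectorField hx
  -- The function is `dq(v)`, for a coordinate `q` with `dq(p) = 1`; it vanishes on `S` because `v`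
  -- does.
  refine ⟨W, hW, hxW, VF.deriv (Sec.res hW v.1) q, p, fun y hy => ?_, VF.eq_deriv_smul hp _⟩
  change q.d y (v.1 ⟨y, hW y.2⟩) = 0
  rw [v.2 ⟨y, hW y.2⟩ hy, map_zero]

/-- The contraction of the product `z w` with `p` agrees with that of `w` and `v = z p`. -/
theorem contract_eq_of_isMul {U W : Opens X} {hW : W ≤ U} {v : VF U} {z : Hol W} {p : VF W}
    (hv : Sec.res hW v = z • p) {w : Form F V (off S U)} {η : Form F V W} (hη : IsMul hW z w η)
    (y : X) (hy : y ∈ off S W) :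
    contract η p ⟨y, hy.1⟩ = w ⟨y, off_mono hW hy⟩ (v ⟨y, hW hy.1⟩) := by
  have h1 : v ⟨y, hW hy.1⟩ = z ⟨y, hy.1⟩ • p ⟨y, hy.1⟩ :=
    congrArg (fun r : VF W => r ⟨y, hy.1⟩) hv
  rw [h1, map_smul]
  change η ⟨y, hy.1⟩ (p ⟨y, hy.1⟩) = _
  rw [hη y hy]
  rfl

/-- The contraction of a logarithmic form with a vector field vanishing on `S` is holomorphic. -/
theorem LogForm.exists_contraction {U : Opens X} (w : LogForm F V S U) (v : LogVF S U) :
    ∃ t : Sec F V U, ∀ (y : X) (hy : y ∈ off S U),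
      t ⟨y, hy.1⟩ = w.1 ⟨y, hy⟩ (v.1 ⟨y, hy.1⟩) := by
  refine Sec.exists_extension (fun y : off S U => w.1 y (v.1 ⟨y, y.2.1⟩)) fun x hx => ?_
  obtain ⟨W, hW, hxW, z, p, hz, hv⟩ := v.exists_local_factor hx
  obtain ⟨η, hη⟩ := w.2 W hW z hz
  exact ⟨W, hW, hxW, contract η p, contract_eq_of_isMul hv hη⟩

/-! ### The first order operators `s ↦ ⟨D(s), v⟩` -/

namespace LogConnection

variable (D : LogConnection F V S)

/-- The section `⟨D(s), v⟩`. -/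
def act {U : Opens X} (v : LogVF S U) (s : Sec F V U) : Sec F V U :=
  (LogForm.exists_contraction (D.toFun U s) v).choose

theorem act_apply {U : Opens X} (v : LogVF S U) (s : Sec F V U) {y : X} (hy : y ∈ off S U) :
    D.act v s ⟨y, hy.1⟩ = (D.toFun U s).1 ⟨y, hy⟩ (v.1 ⟨y, hy.1⟩) :=
  (LogForm.exists_contraction (D.toFun U s) v).choose_spec y hy

/-- Like the identities after it, this is pointwise off `S`, where the contraction is given by a
formula; `Sec.ext_off` carries it across `S`. -/
theorem act_res {U W : Opens X} (hW : W ≤ U) (v : LogVF S U) (s : Sec F V U) :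
    (D.act v s).res hW = D.act (v.res hW) (s.res hW) :=
  Sec.ext_off (S := S) fun y hy => by
    rw [D.act_apply _ _ hy, D.toFun_res]
    exact D.act_apply v s (off_mono hW hy)

theorem act_add_left {U : Opens X} (v w : LogVF S U) (s : Sec F V U) :
    D.act (v + w) s = D.act v s + D.act w s :=
  Sec.ext_off (S := S) fun y hy => by
    rw [Sec.add_apply, D.act_apply _ _ hy, D.act_apply _ _ hy, D.act_apply _ _ hy]
    exact map_add _ _ _

theorem act_smul_left {U : Opens X} (f : Hol U) (v : LogVF S U) (s : Sec F V U) :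
    D.act (f • v) s = f • D.act v s :=
  Sec.ext_off (S := S) fun y hy => by
    rw [Sec.smul_apply, D.act_apply _ _ hy, D.act_apply _ _ hy]
    exact map_smul _ _ _

theorem act_leibniz {U : Opens X} (v : LogVF S U) (f : Hol U) (s : Sec F V U) :
    D.act v (f • s) - f • D.act v s = VF.deriv v.1 f • s :=
  Sec.ext_off (S := S) fun y hy => by
    rw [Sec.sub_apply, Sec.smul_apply, D.act_apply _ _ hy, D.act_apply _ _ hy, D.leibniz]
    exact add_sub_cancel_left _ _

/-- The operator `s ↦ ⟨D(s), v⟩`. -/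
def actHom {U : Opens X} (v : LogVF S U) : Module.End ℂ (Sec F V U) where
  toFun := D.act v
  map_add' s t := Sec.ext_off (S := S) fun y hy => by
    rw [Sec.add_apply, D.act_apply _ _ hy, D.act_apply _ _ hy, D.act_apply _ _ hy, map_add]
    rfl
  map_smul' c s := Sec.ext_off (S := S) fun y hy => by
    rw [RingHom.id_apply, Sec.csmul_apply, D.act_apply _ _ hy, D.act_apply _ _ hy, map_smul]
    rfl

/-- The operator `s ↦ ⟨D(s), v⟩` on the sheaf of sections of `V` over `U`. -/
def op {U : Opens X} (v : LogVF S U) : Op F V U := ⟨fun _ hW => D.actHom (v.res hW)⟩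

theorem symbol_op {U : Opens X} (v : LogVF S U) : symbol (D.op v) = idTensor F V v.1 := by
  funext W hW f
  exact LinearMap.ext fun s => D.act_leibniz (v.res hW) f s

/-- The commutator with `f` is multiplication by the function `v(f)`, which commutes with
multiplication by `g`. -/
theorem op_mem_diff1 {U : Opens X} (v : LogVF S U) : D.op v ∈ Diff1 F V U := by
  refine ⟨fun W W' hW h s => D.act_res h (v.res hW) s, fun W hW f g => ?_⟩
  have h1 : comm ((D.op v).app W hW) f = idTensor F V v.1 W hW f :=
    congrFun (congrFun (congrFun (D.symbol_op v) W) hW) f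
  rw [h1]
  exact LinearMap.ext fun s => sub_eq_zero.2 (smul_comm (VF.deriv (Sec.res hW v.1) f) g s)

variable [ContMDiffVectorBundle ω F V 𝓘(ℂ)]

/-- At a point of `S`, the value of `⟨D(s), v⟩` is a multiple of the residue applied to `s`. -/
theorem exists_act_eq_smul_residue [FiniteDimensional ℂ F] {U : Opens X} (v : LogVF S U)
    (s : Sec F V U) (x : S) (hx : (x : X) ∈ U) :
    ∃ c : ℂ, D.act v s ⟨x, hx⟩ = c • D.residue x (s ⟨x, hx⟩) := by
  obtain ⟨W, hW, hxW, z, p, hz, hv⟩ := v.exists_local_factor hx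
  obtain ⟨η, hη⟩ := (D.toFun U s).2 W hW z hz
  have h1 : (D.act v s).res hW = contract η p := Sec.ext_off (S := S) fun y hy =>
    (D.act_apply v s (off_mono hW hy)).trans (contract_eq_of_isMul hv hη y hy).symm
  have h2 := congrArg (fun r : Sec F V W => r ⟨x, hxW⟩) h1
  -- With `v = z p`, the scalar is `dz(p)` at `x`, because `z D(s)` has the value `dz ⊗ Res(D,
  -- x)(s(x))` there.
  refine ⟨z.d ⟨x, hxW⟩ (p ⟨x, hxW⟩), h2.trans ?_⟩
  change η ⟨x, hxW⟩ (p ⟨x, hxW⟩) = _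
  rw [D.isResidue_residue x U hx s W hW hxW z hz η hη]
  rfl

end LogConnection

end Contraction

/-! ### From a connection preserving the flags to a splitting -/

namespace ParabolicStructure

variable {S : Finset X} {E : ParabolicStructure V S}
variable [T2Space X] [IsManifold 𝓘(ℂ) ω X] [ContMDiffVectorBundle ω F V 𝓘(ℂ)]
  [FiniteDimensional ℂ F]
  [∀ x, IsTopologicalAddGroup (V x)] [∀ x, ContinuousSMul ℂ (V x)]
  {D : LogConnection F V S}

/-- Membership in `ℰ_{x,j}` depends only on the value at `x`, where `⟨D(s), v⟩` is a multiple of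
`Res(D, x)(s(x))`. -/
theorem PreservesFlags.op_mem_at (hD : E.PreservesFlags D) {U : Opens X} (v : LogVF S U) :
    D.op v ∈ E.At F U := by
  refine ⟨⟨D.op_mem_diff1 v, fun W hW x j s hs hx => ?_⟩, v, D.symbol_op v⟩
  obtain ⟨c, hc⟩ := D.exists_act_eq_smul_residue (v.res hW) s x hx
  change D.act (v.res hW) s ⟨x, hx⟩ ∈ _
  rw [hc]
  exact Submodule.smul_mem _ c (hD x _ _ (hs hx))

variable [Nontrivial F]

/-- The splitting `v ↦ (s ↦ ⟨D(s), v⟩)` of the Atiyah sequence given by a logarithmic connection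
whose residues preserve the flags. -/
def PreservesFlags.splitting (hD : E.PreservesFlags D) : E.Splitting F where
  toFun U :=
    { toFun v := ⟨D.op v, hD.op_mem_at v⟩
      map_add' v w := Subtype.ext <| Op.ext fun W hW s =>
        D.act_add_left (v.res hW) (w.res hW) s
      map_smul' f v := Subtype.ext <| Op.ext fun W hW s =>
        D.act_smul_left (f.res hW) (v.res hW) s }
  map_res _ _ := rfl
  sigma_comp U := LinearMap.ext fun v => Subtype.ext <|
    -- A field is determined by its symbol `Id ⊗ v`, the rank being positive.
    idTensor_injective (F := F) (V := V) <| by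
      rw [LinearMap.comp_apply, ← E.symbol_eq]
      exact D.symbol_op v

theorem PreservesFlags.isAssociated_splitting (hD : E.PreservesFlags D) :
    hD.splitting.IsAssociated D := fun _ v s _ hx => (D.act_apply v s hx).symm

end ParabolicStructure

end ParabolicBundle

end

/-! ### The correspondence -/

open ParabolicBundle
theorem corollary1
    {X : Type*} [TopologicalSpace X] [T2Space X] [CompactSpace X] [ConnectedSpace X]
    [ChartedSpace ℂ X] [IsManifold 𝓘(ℂ) ω X]
    {F : Type*} [NormedAddCommGroup F] [NormedSpace ℂ F] [FiniteDimensional ℂ F] [Nontrivial F]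
    {V : X → Type*} [∀ x, AddCommGroup (V x)] [∀ x, Module ℂ (V x)]
    [∀ x, TopologicalSpace (V x)] [∀ x, IsTopologicalAddGroup (V x)]
    [∀ x, ContinuousSMul ℂ (V x)] [TopologicalSpace (TotalSpace F V)]
    [FiberBundle F V] [VectorBundle ℂ F V] [ContMDiffVectorBundle ω F V 𝓘(ℂ)]
    (S : Finset X) (E : ParabolicStructure V S) :
    (∀ h : E.Splitting F, ∃ D : LogConnection F V S,
      h.IsAssociated D ∧ (∀ D', h.IsAssociated D' → D' = D) ∧ E.PreservesFlags D) ∧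
    ∃ Φ : {D : LogConnection F V S // E.IsConnection D} ≃
        {h : E.Splitting F // ∀ (D : LogConnection F V S) (_ : h.IsAssociated D)
          (hD : E.PreservesFlags D) (x : S) (j : Fin (E.len x)),
            E.grResidue hD x j = (E.weight x j : ℂ) • LinearMap.id},
      ∀ D, (Φ D).1.IsAssociated D.1 := by
  refine ⟨fun h => ⟨h.connection, h.isAssociated_connection, fun D' hD' => hD'.eq_connection,
    h.isAssociated_connection.preservesFlags⟩, ?_⟩
  refine ⟨⟨fun D => ⟨D.2.preservesFlags.splitting, fun D' hD' hF x j => ?_⟩,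
    fun h => ⟨h.1.connection, h.1.isAssociated_connection.preservesFlags,
      h.2 _ h.1.isAssociated_connection _⟩, fun D => Subtype.ext ?_, fun h => Subtype.ext ?_⟩,
    fun D => D.2.preservesFlags.isAssociated_splitting⟩
  -- The weight condition on a splitting ranges over all associated connections; by uniqueness, `D`
  -- is the only one.
  · obtain rfl : D' = D.1 :=
      hD'.eq_connection.trans D.2.preservesFlags.isAssociated_splitting.eq_connection.symm
    exact D.2.grResidue_eq x j
  · exact D.2.preservesFlags.isAssociated_splitting.eq_connection.symm
  -- The given splitting and the one rebuilt from its connection share that associated connection,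
  -- which determines a splitting.
  · exact h.1.isAssociated_connection.preservesFlags.isAssociated_splitting.ext
      h.1.isAssociated_connection
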